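/- Let $a(n), v(n)$, $n\ge 1$, be real numbers with $a(n)\neq 0$ for all $n\geq 1$ and $\sum_{n\ge1}|a(n)|^{-1}=\infty$. Let $H_+$ be the self-adjoint operator on $\ell^2(\{1,2,3,\dots\})$ given by $$(H_+\psi)(n)=a(n)\psi(n+1)+a(n-1)\psi(n-1)+v(n)\psi(n),\qquad \psi(0)=0,$$ (so that the value of $a(0)$ is immaterial) on its natural domain $\{\psi\in\ell^2: H_+\psi\in\ell^2\}$. Let $P_S$ denote the spectral projection of $H_+$ on a Borel set $S\subset\mathbb R$, and let $\mu^+(S)=\langle P_S\delta_1,\delta_1\rangle$ be the spectral measure of $\delta_1$. For $E\in\mathbb R$ let $u_0(\cdot,E)$ be the solution of $a(n)u(n+1)+a(n-1)u(n-1)+v(n)u(n)=E\,u(n)$, $n\ge1$, with $u(0)=0$, $u(1)=1$. For $L\ge0$ put $$\|\varphi\|_L^2=\sum_{n=1}^{\lfloor L\rfloor}|\varphi(n)|^2+(L-\lfloor L\rfloor)\,|\varphi(\lfloor L\rfloor+1)|^2,$$ and for $T>0$ put $\langle A(t)\rangle_T=\frac2T\int_0^\infty e^{-2t/T}A(t)\,dt$.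 **Theorem 1.4.** Let $\alpha,\gamma:\mathbb R\to\mathbb R$ be Borel measurable functions such that for $\mu^+$-almost every $E$ $$\limsup_{\epsilon\downarrow0}\frac{\mu^+((E-\epsilon,E+\epsilon))}{(2\epsilon)^{\alpha(E)}}<\infty\qquad\text{and}\qquad \limsup_{L\to\infty}L^{-\gamma(E)}\|u_0(\cdot,E)\|_L^2<\infty ,$$ and let $\eta(E)=\alpha(E)/\gamma(E)$ (with $\eta(E)=0$ where $\gamma(E)=0$). Let $b>0$ and let $S\subset\mathbb R$ be a Borel set such that $\eta(E)\geq b$ for all $E\in S$. Then for every $g>0$ there exists a constant $C_g>0$ such that for all $T>0$ $$\left\langle \|e^{-iH_+t}P_S\delta_1\|^2_{C_gT^b}\right\rangle_T\le 1-\mu^+\left(\{E:\eta(E)\ge b\}\right)+g .$$ -/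

import Mathlib

open Set Filter Topology MeasureTheory
open scoped ENNReal

noncomputable section

/-! ### Spectral calculus of an unbounded self-adjoint operator -/

namespace SpectralCalc

variable {𝓗 : Type*} [NormedAddCommGroup 𝓗] [InnerProductSpace ℂ 𝓗] [CompleteSpace 𝓗]

/-- `P` is a projection-valued Borel measure on `ℝ` (its values on non-Borel sets are irrelevant). -/
structure IsPVM (P : Set ℝ → 𝓗 →L[ℂ] 𝓗) : Prop where
  selfAdjoint : ∀ S, MeasurableSet S → IsSelfAdjoint (P S)
  inter : ∀ S S', MeasurableSet S → MeasurableSet S' → P (S ∩ S') = P S * P S'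
  empty : P ∅ = 0
  univ : P Set.univ = 1
  iUnion : ∀ S : ℕ → Set ℝ, (∀ i, MeasurableSet (S i)) → Pairwise (Function.onFun Disjoint S) →
    ∀ ψ : 𝓗, HasSum (fun i => P (S i) ψ) (P (⋃ i, S i) ψ)

/-- `S ↦ ⟨P(S)ψ, ψ⟩`, with values in `[0, ∞]`. -/
def pvmMass (P : Set ℝ → 𝓗 →L[ℂ] 𝓗) (ψ : 𝓗) (S : Set ℝ) : ℝ≥0∞ :=
  ENNReal.ofReal (inner ℂ ψ (P S ψ)).re

theorem pvmMass_nonneg {P : Set ℝ → 𝓗 →L[ℂ] 𝓗} (hP : IsPVM P) (ψ : 𝓗) {S : Set ℝ}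
    (hS : MeasurableSet S) : 0 ≤ (inner ℂ ψ (P S ψ)).re := by
  have h1 : P S ψ = P S (P S ψ) := by
    have h := hP.inter S S hS hS
    rw [Set.inter_self] at h
    exact congrArg (fun B : 𝓗 →L[ℂ] 𝓗 => B ψ) h
  have h2 : inner ℂ ψ (P S (P S ψ)) = inner ℂ (P S ψ) (P S ψ) := by
    rw [← ContinuousLinearMap.adjoint_inner_left]
    have h := hP.selfAdjoint S hS
    rw [ContinuousLinearMap.isSelfAdjoint_iff'] at h
    rw [h]
  rw [h1, h2]
  exact inner_self_nonneg (𝕜 := ℂ)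

theorem pvmMass_iUnion {P : Set ℝ → 𝓗 →L[ℂ] 𝓗} (hP : IsPVM P) (ψ : 𝓗) (S : ℕ → Set ℝ)
    (hS : ∀ i, MeasurableSet (S i)) (hd : Pairwise (Function.onFun Disjoint S)) :
    pvmMass P ψ (⋃ i, S i) = ∑' i, pvmMass P ψ (S i) := by
  have h1 := hP.iUnion S hS hd ψ
  have h2 : HasSum (fun i => (inner ℂ ψ (P (S i) ψ)).re) (inner ℂ ψ (P (⋃ i, S i) ψ)).re :=
    Complex.hasSum_re (h1.mapL (innerSL ℂ ψ))
  unfold pvmMass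
  rw [← h2.tsum_eq]
  exact ENNReal.ofReal_tsum_of_nonneg (fun i => pvmMass_nonneg hP ψ (hS i)) h2.summable

open Classical in
/-- The scalar measure `μ_ψ(S) = ⟨P(S)ψ, ψ⟩` of a projection-valued measure
(zero if `P` is not a projection-valued measure). -/
def pvmMeasure (P : Set ℝ → 𝓗 →L[ℂ] 𝓗) (ψ : 𝓗) : Measure ℝ :=
  if hP : IsPVM P then
    Measure.ofMeasurable (fun S _ => pvmMass P ψ S)
      (by simp [pvmMass, hP.empty])
      (fun S hS hd => pvmMass_iUnion hP ψ S hS hd)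
  else 0

theorem pvmMeasure_apply {P : Set ℝ → 𝓗 →L[ℂ] 𝓗} (hP : IsPVM P) (ψ : 𝓗) {S : Set ℝ}
    (hS : MeasurableSet S) :
    pvmMeasure P ψ S = ENNReal.ofReal (inner ℂ ψ (P S ψ)).re := by
  rw [pvmMeasure, dif_pos hP, Measure.ofMeasurable_apply S hS, pvmMass]

/-- `P` is the spectral resolution of the operator `A`: it is a projection-valued measure and
`A = ∫ x dP(x)`, that is, the domain of `A` is the set of `ψ` with `∫ x² dμ_ψ(x) < ∞`, and
`⟨Aψ, ψ⟩ = ∫ x dμ_ψ(x)` there. By the spectral theorem every self-adjoint operator has exactly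
one spectral resolution (as a function on Borel sets). -/
structure IsSpectralResolution (A : 𝓗 →ₗ.[ℂ] 𝓗) (P : Set ℝ → 𝓗 →L[ℂ] 𝓗) : Prop where
  isPVM : IsPVM P
  mem_domain : ∀ ψ : 𝓗, ψ ∈ A.domain ↔ ∫⁻ x, ENNReal.ofReal (x ^ 2) ∂(pvmMeasure P ψ) < ⊤
  inner_apply : ∀ ψ : A.domain,
    inner ℂ (ψ : 𝓗) (A ψ) = ((∫ x, x ∂(pvmMeasure P (ψ : 𝓗)) : ℝ) : ℂ)

open Classical in
/-- The spectral projections `P_S` of a self-adjoint operator `A`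
(zero if `A` has no spectral resolution, i.e. is not self-adjoint). -/
def spectralProj (A : 𝓗 →ₗ.[ℂ] 𝓗) : Set ℝ → 𝓗 →L[ℂ] 𝓗 :=
  if h : ∃ P, IsSpectralResolution A P then h.choose else 0

/-- The spectral measure `μ_ψ` of the vector `ψ` for the self-adjoint operator `A`:
`μ_ψ(S) = ⟨P_S ψ, ψ⟩`. -/
def spectralMeasure (A : 𝓗 →ₗ.[ℂ] 𝓗) (ψ : 𝓗) : Measure ℝ :=
  pvmMeasure (spectralProj A) ψ

open Classical in
/-- The bounded operator `f(A)` for a bounded Borel function `f`: the unique bounded operator `B`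
with `⟨Bψ, ψ⟩ = ∫ f dμ_ψ` for all vectors `ψ`. -/
def functionOf (A : 𝓗 →ₗ.[ℂ] 𝓗) (f : ℝ → ℂ) : 𝓗 →L[ℂ] 𝓗 :=
  if h : ∃ B : 𝓗 →L[ℂ] 𝓗, ∀ ψ : 𝓗, inner ℂ ψ (B ψ) = ∫ x, f x ∂(spectralMeasure A ψ)
  then h.choose else 0

/-- The Schrödinger evolution `e^{-iAt}`. -/
def evolution (A : 𝓗 →ₗ.[ℂ] 𝓗) (t : ℝ) : 𝓗 →L[ℂ] 𝓗 :=
  functionOf A fun x => Complex.exp (-Complex.I * (x : ℂ) * (t : ℂ))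

end SpectralCalc

/-! ### Jacobi operators on the half-line `{1, 2, 3, …}` -/

namespace HalfLine

/-- `ℓ²` of the half-line `{1, 2, 3, …}`; the coordinate with index `k : ℕ` is the value at the
site `k + 1`. -/
abbrev L2 : Type := lp (fun _ : ℕ => ℂ) 2

/-- The value of `ψ` at the site `n`, with the Dirichlet convention `ψ(0) = 0`. -/
def atSite (ψ : ℕ → ℂ) : ℕ → ℂ
  | 0 => 0
  | k + 1 => ψ k

/-- The unit vector `δ₁`, supported at the site `1`. -/
def delta1 : L2 := lp.single 2 0 (1 : ℂ)

/-- The Jacobi difference expression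
`(Hψ)(n) = a(n) ψ(n+1) + a(n-1) ψ(n-1) + v(n) ψ(n)` with `ψ(0) = 0`, evaluated at `n = k + 1`. -/
def jacobiExpr (a v : ℕ → ℝ) (ψ : ℕ → ℂ) (k : ℕ) : ℂ :=
  (a (k + 1) : ℂ) * atSite ψ (k + 2) + (a k : ℂ) * atSite ψ k + (v (k + 1) : ℂ) * atSite ψ (k + 1)

theorem jacobiExpr_add (a v : ℕ → ℝ) (ψ φ : ℕ → ℂ) :
    jacobiExpr a v (ψ + φ) = jacobiExpr a v ψ + jacobiExpr a v φ := by
  funext k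
  cases k <;> simp only [jacobiExpr, atSite, Pi.add_apply] <;> ring

theorem jacobiExpr_smul (a v : ℕ → ℝ) (c : ℂ) (ψ : ℕ → ℂ) :
    jacobiExpr a v (c • ψ) = c • jacobiExpr a v ψ := by
  funext k
  cases k <;> simp only [jacobiExpr, atSite, Pi.smul_apply, smul_eq_mul] <;> ring

theorem jacobiExpr_zero (a v : ℕ → ℝ) : jacobiExpr a v 0 = 0 := by
  funext k
  cases k <;> simp [jacobiExpr, atSite]

/-- The half-line operator `H₊` with Dirichlet boundary condition, on its natural domain
`{ψ ∈ ℓ² : Hψ ∈ ℓ²}`. -/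
def jacobiOp (a v : ℕ → ℝ) : L2 →ₗ.[ℂ] L2 where
  domain :=
    { carrier := {ψ | Memℓp (jacobiExpr a v ψ) 2}
      add_mem' := by
        intro ψ φ hψ hφ
        have h := Memℓp.add hψ hφ
        rw [← jacobiExpr_add] at h
        exact h
      zero_mem' := by
        have h : Memℓp (0 : ℕ → ℂ) 2 := zero_memℓp
        rw [← jacobiExpr_zero a v] at h
        exact h
      smul_mem' := by
        intro c ψ hψ
        have h := Memℓp.const_smul hψ c
        rw [← jacobiExpr_smul] at h
        exact h }
  toFun :=
    { toFun := fun ψ => ⟨jacobiExpr a v (ψ : L2), ψ.2⟩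
      map_add' := fun ψ φ => Subtype.ext (jacobiExpr_add a v _ _)
      map_smul' := fun c ψ => Subtype.ext (jacobiExpr_smul a v c _) }

/-- The spectral measure `μ⁺` of `H₊`, i.e. the spectral measure of `δ₁`. -/
def muPlus (a v : ℕ → ℝ) : Measure ℝ :=
  SpectralCalc.spectralMeasure (jacobiOp a v) delta1

/-- The solution `u₀(·, E)` of `a(n) u(n+1) + a(n-1) u(n-1) + v(n) u(n) = E u(n)`, `n ≥ 1`,
with `u(0) = 0` and `u(1) = 1`. -/
def dirichletSol (a v : ℕ → ℝ) (E : ℝ) : ℕ → ℝ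
  | 0 => 0
  | 1 => 1
  | n + 2 => ((E - v (n + 1)) * dirichletSol a v E (n + 1) - a n * dirichletSol a v E n) / a (n + 1)

/-- The truncated norm squared
`‖φ‖_L² = ∑_{n=1}^{⌊L⌋} |φ(n)|² + (L - ⌊L⌋) |φ(⌊L⌋ + 1)|²`, for `L ≥ 0`. -/
def truncNormSq {F : Type*} [Norm F] (φ : ℕ → F) (L : ℝ) : ℝ :=
  ∑ n ∈ Finset.Icc 1 ⌊L⌋₊, ‖φ n‖ ^ 2 + (L - (⌊L⌋₊ : ℝ)) * ‖φ (⌊L⌋₊ + 1)‖ ^ 2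

/-- The time average `⟨A(t)⟩_T = (2/T) ∫₀^∞ e^{-2t/T} A(t) dt`. -/
def timeAvg (A : ℝ → ℝ) (T : ℝ) : ℝ :=
  2 / T * ∫ t in Set.Ioi (0 : ℝ), Real.exp (-2 * t / T) * A t

/-- The upper `s`-derivative `D^s μ(E) = limsup_{ε ↓ 0} μ((E-ε, E+ε)) / (2ε)^s`. -/
def upperDeriv (μ : Measure ℝ) (s E : ℝ) : ℝ≥0∞ :=
  limsup (fun ε : ℝ => μ (Set.Ioo (E - ε) (E + ε)) / ENNReal.ofReal ((2 * ε) ^ s)) (𝓝[>] 0)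

end HalfLine

end

/-! Restricted to a bounded Borel set `B` of energies, the wavepacket has Fourier transforms as site
amplitudes: `(e^{-iHt} P_B δ₁)(n) = ∫_B e^{-iEt} u₀(n,E) dμ⁺(E)` (`atSite_evolution_proj_delta1`).
Squaring and averaging in time replaces the phases by a Lorentzian kernel of width about `1/T` in `E
- E'`. Since that kernel is symmetric, `u(E) u(E') ≤ (u(E)² + u(E')²)/2` leaves `∫_B u₀(n,E)² m_T(E)
dμ⁺(E)`, where `m_T(E)` is the `μ⁺`-mass seen at scale `1/T` around `E` (`timeAvg_fourier_le`).

Summed over the sites `n ≤ M`, the averaged mass in the box is at most the supremum over `B` of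
`‖u₀(·,E)‖_M² m_T(E)`. The first factor is `O(M^γ)` by the growth hypothesis. The second is
`O(T^{-α})` by the continuity of `μ⁺` (`integral_avgKernel_le`), where `α ≤ 1` may be assumed
(`ae_le_one_of_upperDeriv_lt_top`). With `M ≤ r T^b` and `bγ ≤ α` the powers of `T` cancel up to
`O(r^γ)`, small with `r` uniformly in `T` (`growth_mul_avgMass_le`). The implied constants depend on
`E`; `uniformSet` makes them uniform at the price of a set of small `μ⁺`-measure
(`exists_uniformSet_diff_lt`).

The operators are accessible only through their diagonal forms `⟨Qψ,ψ⟩ = ∫ f dμ_ψ`. Polarization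
(`IsPVM.inner_eq_integral`) gives the matrix elements: for `H₊` they yield the recursion of `u₀`,
for the evolution the Fourier formula. Unitarity is replaced by the cruder `‖e^{-iHt} ψ‖ ≤ 2‖ψ‖`.
The resulting bound is `g` alone, which suffices because `μ⁺` has total mass one. -/

/-! ### Finite measures differing by a signed density -/

section MeasureComparison

theorem integral_eq_integral_add_of_real_eq {ν₁ ν₂ m : Measure ℝ} [IsFiniteMeasure ν₁]
    [IsFiniteMeasure ν₂] {w : ℝ → ℝ} (hwm : Measurable w) (hw : Integrable w m)
    (h : ∀ B, MeasurableSet B → ν₁.real B = ν₂.real B + ∫ x in B, w x ∂m)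
    {f : ℝ → ℂ} (hf : Measurable f) (h₁ : Integrable f ν₁) (h₂ : Integrable f ν₂)
    (hfw : Integrable (fun x => f x * (w x : ℂ)) m) :
    ∫ x, f x ∂ν₁ = ∫ x, f x ∂ν₂ + ∫ x, f x * (w x : ℂ) ∂m := by
  have hpm : Measurable fun x => ENNReal.ofReal (w x) := hwm.ennreal_ofReal
  have hnm : Measurable fun x => ENNReal.ofReal (-w x) := hwm.neg.ennreal_ofReal
  -- The negative part of `w` is moved to the other side, so that only positive measures are
  -- compared.
  have key : ν₁ + m.withDensity (fun x => ENNReal.ofReal (-w x))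
      = ν₂ + m.withDensity (fun x => ENNReal.ofReal (w x)) := by
    ext B hB
    simp only [Measure.add_apply, withDensity_apply _ hB]
    have hp : ∫⁻ x in B, ENNReal.ofReal (w x) ∂m ≠ ⊤ :=
      (lt_of_le_of_lt (setLIntegral_le_lintegral _ _) hw.lintegral_lt_top).ne
    have hn : ∫⁻ x in B, ENNReal.ofReal (-w x) ∂m ≠ ⊤ :=
      (lt_of_le_of_lt (setLIntegral_le_lintegral _ _) hw.neg.lintegral_lt_top).ne
    have h3 := h B hB
    rw [integral_eq_lintegral_pos_part_sub_lintegral_neg_part hw.integrableOn] at h3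
    rw [← ENNReal.toReal_eq_toReal_iff' (by finiteness) (by finiteness),
      ENNReal.toReal_add (by finiteness) hn, ENNReal.toReal_add (by finiteness) hp]
    simp only [Measure.real] at h3
    linarith
  have hdom : ∀ s : ℝ → ℝ, Measurable s → (∀ x, |s x| ≤ |w x|) →
      Integrable (fun x => (ENNReal.ofReal (s x)).toReal • f x) m := by
    intro s hs hsw
    refine Integrable.mono hfw (by fun_prop) (Eventually.of_forall fun x => ?_)
    rw [norm_smul, norm_mul, mul_comm, Complex.norm_real, ENNReal.toReal_ofReal']
    gcongr
    rw [Real.norm_eq_abs, Real.norm_eq_abs, abs_of_nonneg (le_max_right _ _)]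
    exact (max_le (le_abs_self _) (abs_nonneg _)).trans (hsw x)
  have hp' := hdom w hwm (fun x => le_rfl)
  have hn' := hdom (fun x => -w x) hwm.neg (fun x => (abs_neg _).le)
  have hfp : Integrable f (m.withDensity fun x => ENNReal.ofReal (w x)) :=
    (integrable_withDensity_iff_integrable_smul₀' hpm.aemeasurable (by simp)).mpr hp'
  have hfn : Integrable f (m.withDensity fun x => ENNReal.ofReal (-w x)) :=
    (integrable_withDensity_iff_integrable_smul₀' hnm.aemeasurable (by simp)).mpr hn'
  have h4 : ∫ x, f x ∂(ν₁ + m.withDensity fun x => ENNReal.ofReal (-w x))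
      = ∫ x, f x ∂(ν₂ + m.withDensity fun x => ENNReal.ofReal (w x)) := by rw [key]
  rw [integral_add_measure h₁ hfn, integral_add_measure h₂ hfp,
    integral_withDensity_eq_integral_toReal_smul hpm (by simp),
    integral_withDensity_eq_integral_toReal_smul hnm (by simp)] at h4
  have h5 : ∫ x, f x * (w x : ℂ) ∂m = ∫ x, (ENNReal.ofReal (w x)).toReal • f x ∂m
      - ∫ x, (ENNReal.ofReal (-w x)).toReal • f x ∂m := by
    rw [← integral_sub hp' hn']
    congr 1
    ext x
    rw [ENNReal.toReal_ofReal', ENNReal.toReal_ofReal', ← sub_smul, Complex.real_smul, mul_comm]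
    congr 2
    rcases le_total 0 (w x) with h | h <;> simp [h]
  rw [h5]
  linear_combination h4

end MeasureComparison

/-! ### Projection-valued measures, polarization and off-diagonal forms -/

namespace SpectralCalc

theorem inner_polarization {𝓗 : Type*} [NormedAddCommGroup 𝓗] [InnerProductSpace ℂ 𝓗]
    {D : Submodule ℂ 𝓗} (Q : D →ₗ[ℂ] 𝓗) (φ ψ : D) :
    4 * inner ℂ (φ : 𝓗) (Q ψ)
      = inner ℂ ((φ + (1 : ℂ) • ψ : D) : 𝓗) (Q (φ + (1 : ℂ) • ψ))
      - inner ℂ ((φ + (-1 : ℂ) • ψ : D) : 𝓗) (Q (φ + (-1 : ℂ) • ψ))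
      - Complex.I * inner ℂ ((φ + Complex.I • ψ : D) : 𝓗) (Q (φ + Complex.I • ψ))
      + Complex.I * inner ℂ ((φ + (-Complex.I) • ψ : D) : 𝓗) (Q (φ + (-Complex.I) • ψ)) := by
  simp only [map_add, map_smul, Submodule.coe_add, Submodule.coe_smul, inner_add_left,
    inner_add_right, inner_smul_left, inner_smul_right, map_neg, Complex.conj_I, map_one]
  ring_nf
  simp only [Complex.I_sq]
  ring

variable {𝓗 : Type*} [NormedAddCommGroup 𝓗] [InnerProductSpace ℂ 𝓗] [CompleteSpace 𝓗]
  {P : Set ℝ → 𝓗 →L[ℂ] 𝓗}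

theorem pvmMeasure_real (hP : IsPVM P) (ψ : 𝓗) {B : Set ℝ} (hB : MeasurableSet B) :
    (pvmMeasure P ψ).real B = (inner ℂ ψ (P B ψ)).re := by
  rw [Measure.real, pvmMeasure_apply hP ψ hB, ENNReal.toReal_ofReal (pvmMass_nonneg hP ψ hB)]

instance pvmMeasure_isFinite (ψ : 𝓗) : IsFiniteMeasure (pvmMeasure P ψ) := by
  by_cases hP : IsPVM P
  · exact ⟨by rw [pvmMeasure_apply hP ψ .univ]; exact ENNReal.ofReal_lt_top⟩
  · rw [pvmMeasure, dif_neg hP]; infer_instance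

theorem IsPVM.inner_left (hP : IsPVM P) {B : Set ℝ} (hB : MeasurableSet B) (φ ψ : 𝓗) :
    inner ℂ (P B φ) ψ = inner ℂ φ (P B ψ) := by
  have h := hP.selfAdjoint B hB
  rw [ContinuousLinearMap.isSelfAdjoint_iff'] at h
  rw [← ContinuousLinearMap.adjoint_inner_left, h]

theorem IsPVM.inter_apply (hP : IsPVM P) {B C : Set ℝ} (hB : MeasurableSet B)
    (hC : MeasurableSet C) (ψ : 𝓗) : P B (P C ψ) = P (B ∩ C) ψ := by
  rw [hP.inter B C hB hC]; rfl

theorem IsPVM.pvmMeasure_real_univ (hP : IsPVM P) (ψ : 𝓗) :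
    (pvmMeasure P ψ).real Set.univ = ‖ψ‖ ^ 2 := by
  rw [pvmMeasure_real hP ψ .univ, hP.univ]
  exact (norm_sq_eq_re_inner (𝕜 := ℂ) ψ).symm

theorem IsPVM.norm_sq_apply (hP : IsPVM P) {B : Set ℝ} (hB : MeasurableSet B) (ψ : 𝓗) :
    ‖P B ψ‖ ^ 2 = (pvmMeasure P ψ).real B := by
  rw [pvmMeasure_real hP ψ hB, norm_sq_eq_re_inner (𝕜 := ℂ), hP.inner_left hB,
    hP.inter_apply hB hB, inter_self]
  rfl

theorem IsPVM.pvmMeasure_apply_restrict (hP : IsPVM P) {B : Set ℝ} (hB : MeasurableSet B) (ψ : 𝓗) :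
    pvmMeasure P (P B ψ) = (pvmMeasure P ψ).restrict B := by
  ext C hC
  rw [Measure.restrict_apply hC, pvmMeasure_apply hP _ hC, pvmMeasure_apply hP _ (hC.inter hB),
    hP.inner_left hB, hP.inter_apply hC hB, hP.inter_apply hB (hC.inter hB)]
  rw [show B ∩ (C ∩ B) = C ∩ B by ext x; simp]

theorem IsPVM.inner_self_eq_real (hP : IsPVM P) {B : Set ℝ} (hB : MeasurableSet B) (ψ : 𝓗) :
    inner ℂ ψ (P B ψ) = ((pvmMeasure P ψ).real B : ℂ) := by
  rw [pvmMeasure_real hP ψ hB]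
  refine (Complex.conj_eq_iff_re.mp ?_).symm
  rw [inner_conj_symm, hP.inner_left hB]

theorem IsPVM.union_apply (hP : IsPVM P) {B C : Set ℝ} (hB : MeasurableSet B)
    (hC : MeasurableSet C) (h : Disjoint B C) (ψ : 𝓗) : P (B ∪ C) ψ = P B ψ + P C ψ := by
  -- Finite additivity is countable additivity for a sequence padded with empty sets.
  let F : ℕ → Set ℝ := fun i => if i = 0 then B else if i = 1 then C else ∅
  have f0 : F 0 = B := rfl
  have f1 : F 1 = C := rfl
  have f2 : ∀ i, i ∉ Finset.range 2 → F i = ∅ := by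
    intro i hi
    have hi : 2 ≤ i := by simpa only [Finset.mem_range, not_lt] using hi
    simp [F, show i ≠ 0 by omega, show i ≠ 1 by omega]
  have hm : ∀ i, MeasurableSet (F i) := by
    intro i
    simp only [F]
    split_ifs <;> simp [hB, hC]
  have hd : Pairwise (Function.onFun Disjoint F) := by
    intro i j hij
    simp only [Function.onFun, F]
    split_ifs <;> simp_all [h.symm]
  have h2 : HasSum (fun i => P (F i) ψ) (∑ i ∈ Finset.range 2, P (F i) ψ) :=
    hasSum_sum_of_ne_finset_zero fun i hi => by simp [f2 i hi, hP.empty]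
  have h3 := (hP.iUnion F hm hd ψ).unique h2
  rw [Finset.sum_range_succ, Finset.sum_range_one, f0, f1] at h3
  rw [← h3]
  congr 2
  ext x
  simp only [mem_union, mem_iUnion]
  constructor
  · rintro (h | h)
    · exact ⟨0, h⟩
    · exact ⟨1, h⟩
  · rintro ⟨i, hi⟩
    simp only [F] at hi
    split_ifs at hi <;> simp_all

theorem IsPVM.real_add_smul (hP : IsPVM P) {B : Set ℝ} (hB : MeasurableSet B) (φ ψ : 𝓗) (c : ℂ) :
    (pvmMeasure P (φ + c • ψ)).real B = (pvmMeasure P φ).real B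
      + ‖c‖ ^ 2 * (pvmMeasure P ψ).real B + 2 * (c * inner ℂ φ (P B ψ)).re := by
  have h1 : inner ℂ ψ (P B φ) = (starRingEnd ℂ) (inner ℂ φ (P B ψ)) := by
    rw [inner_conj_symm, hP.inner_left hB]
  have h2 : (starRingEnd ℂ) c * c = ((‖c‖ ^ 2 : ℝ) : ℂ) := by
    rw [mul_comm, Complex.mul_conj, Complex.normSq_eq_norm_sq]
  have h3 : inner ℂ (φ + c • ψ) (P B (φ + c • ψ)) = inner ℂ φ (P B φ)
      + ((starRingEnd ℂ) c * c) * inner ℂ ψ (P B ψ)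
      + (c * inner ℂ φ (P B ψ) + (starRingEnd ℂ) (c * inner ℂ φ (P B ψ))) := by
    simp only [map_add, map_smul, inner_add_left, inner_add_right, inner_smul_left,
      inner_smul_right, h1, map_mul]
    ring
  rw [pvmMeasure_real hP _ hB, h3, h2, pvmMeasure_real hP _ hB, pvmMeasure_real hP _ hB]
  simp only [Complex.add_re, Complex.re_ofReal_mul, Complex.conj_re]
  ring

/-- If the form of an operator is given on the diagonal by `∫ f dμ_χ`, then it is given off the
diagonal by `∫ f dμ_{φ,ψ}`. -/
theorem IsPVM.inner_eq_integral (hP : IsPVM P) {D : Submodule ℂ 𝓗} (Q : D →ₗ[ℂ] 𝓗) {f : ℝ → ℂ}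
    (hfm : Measurable f) (hf : ∀ χ : D, Integrable f (pvmMeasure P (χ : 𝓗)))
    (hQ : ∀ χ : D, inner ℂ (χ : 𝓗) (Q χ) = ∫ x, f x ∂(pvmMeasure P (χ : 𝓗)))
    (φ ψ : D) {m : Measure ℝ} {w : ℝ → ℝ} (hwm : Measurable w) (hw : Integrable w m)
    (hfw : Integrable (fun x => f x * (w x : ℂ)) m)
    (h : ∀ B, MeasurableSet B → inner ℂ (φ : 𝓗) (P B ψ) = ((∫ x in B, w x ∂m : ℝ) : ℂ)) :
    inner ℂ (φ : 𝓗) (Q ψ) = ∫ x, f x * (w x : ℂ) ∂m := by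
  have e : ∀ c : ℂ, ((φ + c • ψ : D) : 𝓗) = (φ : 𝓗) + c • (ψ : 𝓗) := fun _ => rfl
  -- The real directions `±1` give measures differing by `4 Re ⟨φ, P_B ψ⟩ = 4 ∫_B w dm`.
  have h1 := integral_eq_integral_add_of_real_eq (m := m)
    (ν₁ := pvmMeasure P ((φ + (1 : ℂ) • ψ : D) : 𝓗))
    (ν₂ := pvmMeasure P ((φ + (-1 : ℂ) • ψ : D) : 𝓗)) (hwm.const_mul 4) (hw.const_mul 4)
    (by
      intro B hB
      rw [e, e, hP.real_add_smul hB, hP.real_add_smul hB, h B hB, integral_const_mul]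
      simp
      ring) hfm (hf _) (hf _)
      (by
        convert hfw.const_mul 4 using 2 with x
        push_cast; ring)
  -- The directions `±i` give equal measures because the mixed measure `w dm` is real.
  have h2 := integral_eq_integral_add_of_real_eq (m := m)
    (ν₁ := pvmMeasure P ((φ + Complex.I • ψ : D) : 𝓗))
    (ν₂ := pvmMeasure P ((φ + (-Complex.I) • ψ : D) : 𝓗)) (w := 0) measurable_const
    (integrable_zero _ _ _)
    (by
      intro B hB
      rw [e, e, hP.real_add_smul hB, hP.real_add_smul hB, h B hB]
      simp) hfm (hf _) (hf _) (by simp)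
  have h3 := inner_polarization Q φ ψ
  rw [hQ, hQ, hQ, hQ, h1, h2] at h3
  have h4 : ∫ x, f x * ((4 * w x : ℝ) : ℂ) ∂m = 4 * ∫ x, f x * (w x : ℂ) ∂m := by
    rw [← integral_const_mul]
    congr 1
    ext x
    push_cast; ring
  rw [h4] at h3
  simp at h3
  exact h3

/-- The form is at most `‖χ‖²` on the diagonal. Polarization and the parallelogram law bound it off
the diagonal with the loss of a factor two, which is harmless here. -/
theorem IsPVM.norm_le_of_diagonal (hP : IsPVM P) (Q : 𝓗 →L[ℂ] 𝓗) {f : ℝ → ℂ}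
    (hf : ∀ x, ‖f x‖ ≤ 1) (hQ : ∀ χ : 𝓗, inner ℂ χ (Q χ) = ∫ x, f x ∂(pvmMeasure P χ)) (ψ : 𝓗) :
    ‖Q ψ‖ ≤ 2 * ‖ψ‖ := by
  have hq : ∀ χ : 𝓗, ‖(inner ℂ χ (Q χ) : ℂ)‖ ≤ ‖χ‖ ^ 2 := by
    intro χ
    rw [hQ, ← hP.pvmMeasure_real_univ]
    exact (norm_integral_le_of_norm_le_const (C := 1) (Eventually.of_forall hf)).trans
      (one_mul _).le
  have hb : ∀ φ χ : 𝓗, ‖φ‖ = ‖χ‖ → ‖(inner ℂ φ (Q χ) : ℂ)‖ ≤ 2 * ‖χ‖ ^ 2 := by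
    intro φ χ hφ
    have h3 := inner_polarization ((Q : 𝓗 →ₗ[ℂ] 𝓗) ∘ₗ (⊤ : Submodule ℂ 𝓗).subtype)
      ⟨φ, trivial⟩ ⟨χ, trivial⟩
    simp only [LinearMap.comp_apply, Submodule.subtype_apply, ContinuousLinearMap.coe_coe,
      Submodule.coe_add, Submodule.coe_smul] at h3
    have h4 := congrArg norm h3
    have p1 := parallelogram_law_with_norm ℂ φ χ
    have p2 := parallelogram_law_with_norm ℂ φ (Complex.I • χ)
    have q1 := hq (φ + (1 : ℂ) • χ)
    have q2 := hq (φ + (-1 : ℂ) • χ)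
    have q3 := hq (φ + Complex.I • χ)
    have q4 := hq (φ + (-Complex.I) • χ)
    rw [one_smul] at q1 h4
    rw [neg_one_smul, ← sub_eq_add_neg] at q2 h4
    rw [neg_smul, ← sub_eq_add_neg] at q4 h4
    rw [norm_mul] at h4
    have h5 : ∀ z₁ z₂ z₃ z₄ : ℂ, ‖z₁ - z₂ - Complex.I * z₃ + Complex.I * z₄‖
        ≤ ‖z₁‖ + ‖z₂‖ + ‖z₃‖ + ‖z₄‖ := by
      intro z₁ z₂ z₃ z₄
      refine (norm_add_le _ _).trans ?_
      rw [norm_mul, Complex.norm_I, one_mul]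
      gcongr
      refine (norm_sub_le _ _).trans ?_
      rw [norm_mul, Complex.norm_I, one_mul]
      gcongr
      exact norm_sub_le _ _
    have h6 := h4.le.trans (h5 _ _ _ _)
    rw [norm_smul, Complex.norm_I, one_mul] at p2
    rw [hφ] at p1 p2
    rw [show ‖(4 : ℂ)‖ = 4 by norm_num] at h6
    linarith
  by_cases h0 : Q ψ = 0
  · rw [h0, norm_zero]; positivity
  by_cases h1 : ψ = 0
  · simp [h1]
  have n0 : 0 < ‖Q ψ‖ := norm_pos_iff.mpr h0
  have n1 : 0 < ‖ψ‖ := norm_pos_iff.mpr h1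
  -- The test vector is `Qψ` rescaled to the length of `ψ`, as `hb` requires equal norms.
  have h2 := hb (((‖ψ‖ / ‖Q ψ‖ : ℝ) : ℂ) • Q ψ) ψ (by
    rw [norm_smul, Complex.norm_real, Real.norm_of_nonneg (by positivity)]
    field_simp)
  rw [inner_smul_left, norm_mul, inner_self_eq_norm_sq_to_K, RCLike.norm_conj, Complex.norm_real,
    Real.norm_of_nonneg (by positivity)] at h2
  norm_num at h2
  have h3 : ‖ψ‖ / ‖Q ψ‖ * ‖Q ψ‖ ^ 2 = ‖ψ‖ * ‖Q ψ‖ := by field_simp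
  rw [h3] at h2
  nlinarith

theorem isSpectralResolution_spectralProj {A : 𝓗 →ₗ.[ℂ] 𝓗} (h : ∃ P, IsSpectralResolution A P) :
    IsSpectralResolution A (spectralProj A) := by
  rw [spectralProj, dif_pos h]
  exact h.choose_spec

theorem IsSpectralResolution.integrable_id {A : 𝓗 →ₗ.[ℂ] 𝓗} (h : IsSpectralResolution A P)
    (ψ : A.domain) : Integrable (fun x : ℝ => (x : ℂ)) (pvmMeasure P (ψ : 𝓗)) := by
  have h1 := (h.mem_domain ψ).mp ψ.2
  have h2 : MemLp (fun x : ℝ => x) 2 (pvmMeasure P (ψ : 𝓗)) := by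
    refine ⟨measurable_id.aestronglyMeasurable, ?_⟩
    rw [eLpNorm_lt_top_iff_lintegral_rpow_enorm_lt_top (by norm_num) (by norm_num)]
    convert h1 using 2
    ext x
    rw [← ofReal_norm, ENNReal.ofReal_rpow_of_nonneg (by positivity) (by norm_num)]
    norm_num
  exact (h2.integrable (by norm_num)).ofReal

end SpectralCalc

/-! ### Bounded Borel functions of an operator and the evolution -/

namespace SpectralCalc

variable {𝓗 : Type*} [NormedAddCommGroup 𝓗] [InnerProductSpace ℂ 𝓗] [CompleteSpace 𝓗]
  {P : Set ℝ → 𝓗 →L[ℂ] 𝓗}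

theorem IsPVM.norm_le_of_diagonal_bound (hP : IsPVM P) (Q : 𝓗 →L[ℂ] 𝓗) {f : ℝ → ℂ} {c : ℝ}
    (hc : 0 < c) (hf : ∀ x, ‖f x‖ ≤ c)
    (hQ : ∀ χ : 𝓗, inner ℂ χ (Q χ) = ∫ x, f x ∂(pvmMeasure P χ)) : ‖Q‖ ≤ 2 * c := by
  refine Q.opNorm_le_bound (by positivity) fun ψ => ?_
  have h := hP.norm_le_of_diagonal ((c⁻¹ : ℂ) • Q) (f := fun x => (c⁻¹ : ℂ) * f x)
    (by
      intro x
      rw [norm_mul, norm_inv, Complex.norm_real, Real.norm_of_nonneg hc.le,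
        inv_mul_le_iff₀ hc, mul_one]
      exact hf x)
    (by
      intro χ
      rw [smul_apply, inner_smul_right, hQ, integral_const_mul]) ψ
  rw [smul_apply, norm_smul, norm_inv, Complex.norm_real,
    Real.norm_of_nonneg hc.le, inv_mul_le_iff₀ hc] at h
  linarith

theorem IsPVM.exists_diagonal_simpleFunc (hP : IsPVM P) (s : SimpleFunc ℝ ℂ) :
    ∃ Q : 𝓗 →L[ℂ] 𝓗, ∀ χ : 𝓗, inner ℂ χ (Q χ) = ∫ x, s x ∂(pvmMeasure P χ) := by
  refine ⟨∑ y ∈ s.range, y • P (s ⁻¹' {y}), fun χ => ?_⟩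
  rw [SimpleFunc.integral_eq_sum _ s.integrable_of_isFiniteMeasure, sum_apply, inner_sum]
  refine Finset.sum_congr rfl fun y _ => ?_
  rw [smul_apply, inner_smul_right,
    hP.inner_self_eq_real (s.measurableSet_fiber y), Complex.real_smul, mul_comm]

theorem exists_simpleFunc_uniform_approx {f : ℝ → ℂ} (hf : Measurable f) {c : ℝ}
    (hc : ∀ x, ‖f x‖ ≤ c) {ε : ℝ} (hε : 0 < ε) :
    ∃ s : SimpleFunc ℝ ℂ, ∀ x, ‖s x - f x‖ ≤ ε := by
  let e := TopologicalSpace.denseSeq ℂ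
  obtain ⟨t, ht⟩ := (isCompact_closedBall (0 : ℂ) c).elim_finite_subcover
    (fun k => Metric.ball (e k) ε) (fun k => Metric.isOpen_ball) (by
      intro y _
      obtain ⟨k, hk⟩ := (TopologicalSpace.denseRange_denseSeq ℂ).exists_dist_lt y hε
      exact mem_iUnion.mpr ⟨k, hk⟩)
  -- The range of `f` lies in a compact ball, so finitely many points of a dense sequence form an
  -- `ε`-net; rounding to the nearest of the points up to the largest index used is simple and
  -- uniformly close.
  refine ⟨(SimpleFunc.nearestPt e (t.sup id)).comp f hf, fun x => ?_⟩
  have hx := ht (show f x ∈ Metric.closedBall (0 : ℂ) c by simpa using hc x)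
  simp only [mem_iUnion, exists_prop] at hx
  obtain ⟨k, hk, hxk⟩ := hx
  have h := SimpleFunc.edist_nearestPt_le e (f x) (Finset.le_sup (f := id) hk)
  rw [edist_dist, edist_dist, ENNReal.ofReal_le_ofReal_iff dist_nonneg, dist_eq_norm] at h
  rw [Metric.mem_ball, dist_comm] at hxk
  exact h.trans hxk.le

/-- A bounded Borel function of a projection-valued measure exists as a bounded operator. -/
theorem IsPVM.exists_diagonal (hP : IsPVM P) {f : ℝ → ℂ} (hf : Measurable f) {c : ℝ}
    (hc : ∀ x, ‖f x‖ ≤ c) :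
    ∃ Q : 𝓗 →L[ℂ] 𝓗, ∀ χ : 𝓗, inner ℂ χ (Q χ) = ∫ x, f x ∂(pvmMeasure P χ) := by
  have hu : ∀ n : ℕ, (0 : ℝ) < 1 / ((n : ℝ) + 1) := fun n => Nat.one_div_pos_of_nat
  choose s hs using fun n : ℕ => exists_simpleFunc_uniform_approx hf hc (hu n)
  choose Q hQ using fun n => hP.exists_diagonal_simpleFunc (s n)
  have hint : ∀ (g : SimpleFunc ℝ ℂ) (χ : 𝓗), Integrable g (pvmMeasure P χ) :=
    fun g χ => g.integrable_of_isFiniteMeasure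
  have hfint : ∀ χ : 𝓗, Integrable f (pvmMeasure P χ) := fun χ =>
    Integrable.of_bound hf.aestronglyMeasurable c (Eventually.of_forall hc)
  -- Uniform closeness of the symbols becomes operator norm closeness, so the operators converge in
  -- norm.
  have hdiff : ∀ m n : ℕ, ‖Q m - Q n‖ ≤ 2 * (1 / ((m : ℝ) + 1) + 1 / ((n : ℝ) + 1)) := by
    intro m n
    refine hP.norm_le_of_diagonal_bound _ (add_pos (hu m) (hu n))
      (f := fun x => s m x - s n x) (fun x => ?_) (fun χ => ?_)
    · rw [show s m x - s n x = (s m x - f x) - (s n x - f x) by ring]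
      exact (norm_sub_le _ _).trans (add_le_add (hs m x) (hs n x))
    · rw [sub_apply, inner_sub_right, hQ, hQ,
        integral_sub (hint _ _) (hint _ _)]
  have hcau : CauchySeq Q := by
    refine cauchySeq_of_le_tendsto_0 (fun n : ℕ => 4 * (1 / ((n : ℝ) + 1))) (fun m n N hm hn => ?_) ?_
    · rw [dist_eq_norm]
      have h1 := Nat.one_div_le_one_div (α := ℝ) hm
      have h2 := Nat.one_div_le_one_div (α := ℝ) hn
      linarith [hdiff m n]
    · simpa using (tendsto_one_div_add_atTop_nhds_zero_nat (𝕜 := ℝ)).const_mul 4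
  obtain ⟨R, hR⟩ := cauchySeq_tendsto_of_complete hcau
  refine ⟨R, fun χ => ?_⟩
  have h1 : Tendsto (fun n => inner ℂ χ (Q n χ)) atTop (𝓝 (inner ℂ χ (R χ))) :=
    ((innerSL ℂ χ).continuous.tendsto _).comp
      (((ContinuousLinearMap.apply ℂ 𝓗 χ).continuous.tendsto R).comp hR)
  refine tendsto_nhds_unique h1 ?_
  simp only [hQ]
  rw [tendsto_iff_norm_sub_tendsto_zero]
  refine squeeze_zero (fun _ => norm_nonneg _)
    (g := fun n : ℕ => (1 / ((n : ℝ) + 1)) * (pvmMeasure P χ).real Set.univ) (fun n => ?_) ?_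
  · rw [← integral_sub (hint _ _) (hfint χ)]
    exact norm_integral_le_of_norm_le_const (Eventually.of_forall (hs n))
  · simpa using (tendsto_one_div_add_atTop_nhds_zero_nat (𝕜 := ℝ)).mul_const
      ((pvmMeasure P χ).real Set.univ)

theorem norm_exp_neg_I_mul (x t : ℝ) : ‖Complex.exp (-Complex.I * (x : ℂ) * (t : ℂ))‖ = 1 := by
  rw [show -Complex.I * (x : ℂ) * (t : ℂ) = ((-(x * t) : ℝ) : ℂ) * Complex.I by push_cast; ring]
  exact Complex.norm_exp_ofReal_mul_I _

theorem measurable_exp_neg_I_mul (t : ℝ) :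
    Measurable fun x : ℝ => Complex.exp (-Complex.I * (x : ℂ) * (t : ℂ)) :=
  Continuous.measurable (by fun_prop)

/-- `functionOf` falls back to zero when no operator has the prescribed form; the existence theorem
excludes that branch. -/
theorem inner_evolution {A : 𝓗 →ₗ.[ℂ] 𝓗} (hA : ∃ P, IsSpectralResolution A P) (t : ℝ) (χ : 𝓗) :
    inner ℂ χ (evolution A t χ) = ∫ x : ℝ, Complex.exp (-Complex.I * (x : ℂ) * (t : ℂ))
      ∂(pvmMeasure (spectralProj A) χ) := by
  have h := (isSpectralResolution_spectralProj hA).isPVM.exists_diagonal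
    (measurable_exp_neg_I_mul t) (fun x => (norm_exp_neg_I_mul x t).le)
  rw [evolution, functionOf]
  split_ifs with h'
  · exact h'.choose_spec χ
  · exact absurd h h'

theorem norm_evolution_le {A : 𝓗 →ₗ.[ℂ] 𝓗} (hA : ∃ P, IsSpectralResolution A P) (t : ℝ) (ψ : 𝓗) :
    ‖evolution A t ψ‖ ≤ 2 * ‖ψ‖ :=
  (isSpectralResolution_spectralProj hA).isPVM.norm_le_of_diagonal _
    (fun x => (norm_exp_neg_I_mul x t).le) (inner_evolution hA t) ψ

end SpectralCalc

/-! ### Expansion in the solutions `u₀` -/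

namespace HalfLine

open SpectralCalc

theorem jacobiExpr_single_eq_zero (a v : ℕ → ℝ) (n k : ℕ) (hk : n + 1 < k) :
    jacobiExpr a v (lp.single 2 n (1 : ℂ) : L2) k = 0 := by
  obtain ⟨j, rfl⟩ : ∃ j, k = j + 1 := ⟨k - 1, by omega⟩
  simp only [jacobiExpr, atSite, lp.coeFn_single]
  rw [Pi.single_eq_of_ne (by omega), Pi.single_eq_of_ne (by omega), Pi.single_eq_of_ne (by omega)]
  simp

theorem single_mem_domain (a v : ℕ → ℝ) (n : ℕ) :
    (lp.single 2 n (1 : ℂ) : L2) ∈ (jacobiOp a v).domain := by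
  refine memℓp_gen (p := 2) ?_
  refine summable_of_ne_finset_zero (s := Finset.range (n + 2)) fun k hk => ?_
  rw [jacobiExpr_single_eq_zero a v n k (by simp only [Finset.mem_range] at hk; omega)]
  simp

theorem continuous_dirichletSol (a v : ℕ → ℝ) (n : ℕ) :
    Continuous fun E => dirichletSol a v E n := by
  induction n using Nat.strong_induction_on with
  | _ n ih =>
    match n with
    | 0 => exact continuous_const
    | 1 => exact continuous_const
    | k + 2 =>
      have h1 := ih (k + 1) (by omega)
      have h2 := ih k (by omega)
      simp only [dirichletSol]
      fun_prop

theorem norm_delta1 : ‖delta1‖ = 1 := by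
  rw [delta1, lp.norm_single (by norm_num)]
  simp

/-- The recursion satisfied by `u₀`. -/
theorem dirichletSol_recursion {a : ℕ → ℝ} (v : ℕ → ℝ) (ha : ∀ n, 1 ≤ n → a n ≠ 0) (E : ℝ) (n : ℕ) :
    a (n + 1) * dirichletSol a v E (n + 2)
      = E * dirichletSol a v E (n + 1) - v (n + 1) * dirichletSol a v E (n + 1)
        - a n * dirichletSol a v E n := by
  have := ha (n + 1) (by omega)
  simp only [dirichletSol]
  field_simp

theorem integrableOn_of_continuous_of_bounded {B : Set ℝ} {R : ℝ} (hBR : B ⊆ Icc (-R) R)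
    (μ : Measure ℝ) [IsFiniteMeasure μ] {F : Type*} [NormedAddCommGroup F] {f : ℝ → F}
    (hf : Continuous f) : IntegrableOn f B μ :=
  (hf.continuousOn.integrableOn_compact isCompact_Icc).mono_set hBR

/-- The spectral measure of `P_B δ₁` is the restriction to `B` of that of `δ₁`, whose second moment
is finite because `δ₁` has finite support. -/
theorem proj_delta1_mem_domain {a v : ℕ → ℝ} {P : Set ℝ → L2 →L[ℂ] L2}
    (hP : IsSpectralResolution (jacobiOp a v) P) {B : Set ℝ} (hB : MeasurableSet B) :
    P B delta1 ∈ (jacobiOp a v).domain := by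
  rw [hP.mem_domain, hP.isPVM.pvmMeasure_apply_restrict hB]
  exact lt_of_le_of_lt (setLIntegral_le_lintegral _ _)
    ((hP.mem_domain _).mp (single_mem_domain a v 0))

theorem inner_single_eq_atSite (n : ℕ) (ψ : L2) :
    inner ℂ (lp.single 2 n (1 : ℂ) : L2) ψ = atSite ψ (n + 1) := by
  rw [lp.inner_single_left]
  simp [atSite]

/-- The generalized eigenfunction expansion: on a bounded Borel set `B`, the spectral projection of
`δ₁` is given by integrating the solution `u₀`. -/
theorem atSite_proj_delta1 {a v : ℕ → ℝ} (ha : ∀ n, 1 ≤ n → a n ≠ 0) {P : Set ℝ → L2 →L[ℂ] L2}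
    (hP : IsSpectralResolution (jacobiOp a v) P) {R : ℝ} (n : ℕ) {B : Set ℝ} (hB : MeasurableSet B)
    (hBR : B ⊆ Icc (-R) R) :
    atSite (P B delta1) n
      = ((∫ E in B, dirichletSol a v E n ∂(pvmMeasure P delta1) : ℝ) : ℂ) := by
  induction n using Nat.strong_induction_on generalizing B with
  | _ n ih =>
    match n with
    | 0 => simp [atSite, dirichletSol]
    | 1 =>
      rw [← inner_single_eq_atSite]
      simp only [dirichletSol]
      rw [setIntegral_const, smul_eq_mul, mul_one]
      exact hP.isPVM.inner_self_eq_real hB delta1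
    | k + 2 =>
      have h0 := ih k (by omega) hB hBR
      have h1 := ih (k + 1) (by omega) hB hBR
      have hc := continuous_dirichletSol a v
      set μ := pvmMeasure P delta1 with hμ
      have hI : ∀ n, IntegrableOn (fun E => dirichletSol a v E n) B μ :=
        fun n => integrableOn_of_continuous_of_bounded hBR μ (hc n)
      have hIE : IntegrableOn (fun E => E * dirichletSol a v E (k + 1)) B μ :=
        integrableOn_of_continuous_of_bounded hBR μ (by have := hc (k + 1); fun_prop)
      have hform := hP.isPVM.inner_eq_integral (f := fun x : ℝ => (x : ℂ)) (jacobiOp a v).toFun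
        (by fun_prop)
        (fun χ => hP.integrable_id χ)
        (fun χ => (hP.inner_apply χ).trans integral_ofReal.symm)
        -- Coordinate `k` is the site `k + 1`: pairing this unit vector with `H₊ P_B δ₁` reads off
        -- the difference equation centred at `k + 1`.
        ⟨lp.single 2 k (1 : ℂ), single_mem_domain a v k⟩ ⟨P B delta1, proj_delta1_mem_domain hP hB⟩
        (m := μ.restrict B) (w := fun E => dirichletSol a v E (k + 1)) (hc _).measurable (hI _)
        (by
          have : Integrable (fun E => ((E * dirichletSol a v E (k + 1) : ℝ) : ℂ)) (μ.restrict B) :=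
            hIE.ofReal
          simpa only [Complex.ofReal_mul] using this)
        (by
          intro C hC
          simp only
          rw [hP.isPVM.inter_apply hC hB, inner_single_eq_atSite, Measure.restrict_restrict hC]
          -- The mixed measure of `δ_{k+1}` and `P_B δ₁` must be known on every Borel `C`; this is
          -- why the induction varies the set.
          exact ih (k + 1) (by omega) (hC.inter hB) (inter_subset_right.trans hBR))
      rw [inner_single_eq_atSite] at hform
      have h2 : ∫ x in B, (x : ℂ) * (dirichletSol a v x (k + 1) : ℂ) ∂μ
          = ((∫ x in B, x * dirichletSol a v x (k + 1) ∂μ : ℝ) : ℂ) := by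
        rw [← integral_complex_ofReal]
        simp only [Complex.ofReal_mul]
      rw [h2] at hform
      have h3 : jacobiExpr a v (P B delta1) k
          = ((∫ x in B, x * dirichletSol a v x (k + 1) ∂μ : ℝ) : ℂ) := hform
      rw [jacobiExpr, h0, h1] at h3
      have h4 : a (k + 1) * ∫ E in B, dirichletSol a v E (k + 2) ∂μ
          = ∫ E in B, E * dirichletSol a v E (k + 1) ∂μ
            - v (k + 1) * ∫ E in B, dirichletSol a v E (k + 1) ∂μ
            - a k * ∫ E in B, dirichletSol a v E k ∂μ := by
        rw [← integral_const_mul, ← integral_const_mul, ← integral_const_mul,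
          ← integral_sub hIE ((hI _).const_mul _), 
          ← integral_sub (f := fun E => E * dirichletSol a v E (k + 1)
            - v (k + 1) * dirichletSol a v E (k + 1)) (hIE.sub ((hI _).const_mul _))
            ((hI _).const_mul _)]
        simp only [dirichletSol_recursion v ha]
      have h5 := congrArg (fun r : ℝ => (r : ℂ)) h4
      simp only [Complex.ofReal_mul, Complex.ofReal_sub] at h5
      have h6 : (a (k + 1) : ℂ) ≠ 0 := Complex.ofReal_ne_zero.mpr (ha _ (by omega))
      -- Both the amplitudes and the integrals of `u₀` obey the same three-term recursion, solvable
      -- for the next site since `a (k + 1) ≠ 0`.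
      refine mul_left_cancel₀ h6 ?_
      rw [h5]
      linear_combination h3

theorem atSite_evolution_proj_delta1 {a v : ℕ → ℝ} (ha : ∀ n, 1 ≤ n → a n ≠ 0)
    (hA : ∃ P, IsSpectralResolution (jacobiOp a v) P) {R : ℝ} (n : ℕ) {B : Set ℝ}
    (hB : MeasurableSet B) (hBR : B ⊆ Icc (-R) R) (t : ℝ) :
    atSite (evolution (jacobiOp a v) t (spectralProj (jacobiOp a v) B delta1)) n
      = ∫ E in B, Complex.exp (-Complex.I * (E : ℂ) * (t : ℂ)) * (dirichletSol a v E n : ℂ)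
        ∂(muPlus a v) := by
  cases n with
  | zero => simp [atSite, dirichletSol]
  | succ n =>
    have hP := isSpectralResolution_spectralProj hA
    have hc := continuous_dirichletSol a v (n + 1)
    rw [← inner_single_eq_atSite]
    refine hP.isPVM.inner_eq_integral
      ((evolution (jacobiOp a v) t : L2 →ₗ[ℂ] L2) ∘ₗ (⊤ : Submodule ℂ L2).subtype)
      (measurable_exp_neg_I_mul t)
      (fun χ => Integrable.of_bound (measurable_exp_neg_I_mul t).aestronglyMeasurable 1
        (Eventually.of_forall fun x => (norm_exp_neg_I_mul x t).le))
      (fun χ => inner_evolution hA t (χ : L2)) ⟨lp.single 2 n 1, trivial⟩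
      ⟨spectralProj (jacobiOp a v) B delta1, trivial⟩ (m := (muPlus a v).restrict B) hc.measurable
      (integrableOn_of_continuous_of_bounded hBR (pvmMeasure _ _) hc)
      (integrableOn_of_continuous_of_bounded hBR (pvmMeasure _ _) (by fun_prop)) ?_
    intro C hC
    simp only
    rw [hP.isPVM.inter_apply hC hB, inner_single_eq_atSite, Measure.restrict_restrict hC]
    exact atSite_proj_delta1 ha hP _ (hC.inter hB) (inter_subset_right.trans hBR)

end HalfLine

/-! ### Time averages of Fourier transforms and the Lorentzian kernel -/

namespace HalfLine

/-- The kernel `∫₀^∞ (2/T) e^{-2t/T} cos(tx) dt`. -/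
noncomputable def avgKernel (T x : ℝ) : ℝ := (1 + (T * x / 2) ^ 2)⁻¹

theorem avgKernel_nonneg (T x : ℝ) : 0 ≤ avgKernel T x := by
  unfold avgKernel; positivity

theorem avgKernel_le_one (T x : ℝ) : avgKernel T x ≤ 1 :=
  inv_le_one_of_one_le₀ (by nlinarith [sq_nonneg (T * x / 2)])

theorem continuous_avgKernel (T : ℝ) : Continuous (avgKernel T) := by
  unfold avgKernel
  exact Continuous.inv₀ (by fun_prop) fun x => by positivity

theorem avgKernel_neg (T x : ℝ) : avgKernel T (-x) = avgKernel T x := by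
  unfold avgKernel; ring

theorem avgKernel_anti {T T' : ℝ} (hT : 0 ≤ T) (h : T ≤ T') (x : ℝ) :
    avgKernel T' x ≤ avgKernel T x := by
  unfold avgKernel
  rw [mul_div_assoc, mul_div_assoc, mul_pow, mul_pow]
  gcongr

theorem integrable_avgKernel (T E : ℝ) (μ : Measure ℝ) [IsFiniteMeasure μ] :
    Integrable (fun x => avgKernel T (E - x)) μ :=
  Integrable.of_bound
    ((continuous_avgKernel T).comp (continuous_const.sub continuous_id)).aestronglyMeasurable 1
    (Eventually.of_forall fun x => by
      rw [Real.norm_of_nonneg (avgKernel_nonneg _ _)]; exact avgKernel_le_one _ _)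

theorem timeAvg_exp (T : ℝ) (hT : 0 < T) (x : ℝ) :
    ∫ t in Ioi (0 : ℝ), ((2 / T * Real.exp (-2 * t / T) : ℝ) : ℂ)
      * Complex.exp (-Complex.I * (x : ℂ) * (t : ℂ)) = (1 + Complex.I * (T * x / 2 : ℝ))⁻¹ := by
  have hT' : (T : ℂ) ≠ 0 := Complex.ofReal_ne_zero.mpr hT.ne'
  have h1 : ∀ t : ℝ, ((2 / T * Real.exp (-2 * t / T) : ℝ) : ℂ)
      * Complex.exp (-Complex.I * (x : ℂ) * (t : ℂ))
      = (2 / T : ℂ) * Complex.exp ((-2 / T - Complex.I * x) * t) := by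
    intro t
    push_cast
    rw [mul_assoc, ← Complex.exp_add]
    congr 2
    ring
  simp_rw [h1]
  rw [integral_const_mul, integral_exp_mul_complex_Ioi (by
    rw [show (-2 / T - Complex.I * x : ℂ) = ((-2 / T : ℝ) : ℂ) - Complex.I * x by push_cast; ring]
    simp
    exact div_neg_of_neg_of_pos (by norm_num) hT)]
  have h2 : (-2 / T - Complex.I * x : ℂ) ≠ 0 := by
    intro h
    have := congrArg Complex.re h
    rw [show (-2 / T - Complex.I * x : ℂ) = ((-2 / T : ℝ) : ℂ) - Complex.I * x by push_cast; ring]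
      at this
    simp at this
    exact hT.ne' this
  have h3 : (1 + Complex.I * (T * x / 2 : ℝ) : ℂ) = -(T / 2) * (-2 / T - Complex.I * x) := by
    push_cast; field_simp; ring
  rw [h3]
  simp only [Complex.ofReal_zero, mul_zero, Complex.exp_zero]
  field_simp

theorem re_inv_one_add_I_mul (T x : ℝ) :
    ((1 + Complex.I * (T * x / 2 : ℝ))⁻¹ : ℂ).re = avgKernel T x := by
  rw [Complex.inv_re, Complex.normSq_apply, avgKernel]
  simp only [Complex.add_re, Complex.one_re, Complex.mul_re, Complex.I_re, Complex.ofReal_re,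
    Complex.I_im, Complex.ofReal_im, Complex.add_im, Complex.one_im, Complex.mul_im]
  ring_nf

section

variable {m : Measure ℝ} [IsFiniteMeasure m] {u : ℝ → ℝ} {c T : ℝ}

theorem continuous_fourier (hu : Measurable u) (hc : ∀ x, |u x| ≤ c) :
    Continuous fun t : ℝ => ∫ E, Complex.exp (-Complex.I * (E : ℂ) * (t : ℂ)) * (u E : ℂ) ∂m := by
  refine continuous_of_dominated (bound := fun _ => c) (fun t => ?_) (fun t => ?_)
    (integrable_const c) (Eventually.of_forall fun E => by fun_prop)
  · exact ((SpectralCalc.measurable_exp_neg_I_mul t).mul (by fun_prop)).aestronglyMeasurable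
  · refine Eventually.of_forall fun E => ?_
    rw [norm_mul, SpectralCalc.norm_exp_neg_I_mul, one_mul, Complex.norm_real]
    exact hc E

theorem norm_fourier_le (hc : ∀ x, |u x| ≤ c) (t : ℝ) :
    ‖∫ E, Complex.exp (-Complex.I * (E : ℂ) * (t : ℂ)) * (u E : ℂ) ∂m‖ ≤ c * m.real univ := by
  refine norm_integral_le_of_norm_le_const (Eventually.of_forall fun E => ?_)
  rw [norm_mul, SpectralCalc.norm_exp_neg_I_mul, one_mul, Complex.norm_real]
  exact hc E

theorem integrableOn_exp_weight (hT : 0 < T) :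
    IntegrableOn (fun t : ℝ => Real.exp (-2 * t / T)) (Ioi 0) := by
  have h := integrableOn_exp_mul_Ioi (a := -2 / T) (div_neg_of_neg_of_pos (by norm_num) hT) 0
  refine h.congr_fun (fun t _ => ?_) measurableSet_Ioi
  simp only
  congr 1; ring

theorem integral_exp_weight (hT : 0 < T) :
    ∫ t in Ioi (0 : ℝ), Real.exp (-2 * t / T) = T / 2 := by
  have h := integral_exp_mul_Ioi (a := -2 / T) (div_neg_of_neg_of_pos (by norm_num) hT) 0
  rw [mul_zero, Real.exp_zero] at h
  rw [show T / 2 = -1 / (-2 / T) by field_simp, ← h]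
  refine integral_congr_ae (Eventually.of_forall fun t => ?_)
  simp only
  congr 1; ring

theorem integrableOn_weight_mul_of_bounded (hT : 0 < T) {A : ℝ → ℝ} (hA : Continuous A) {C : ℝ}
    (hC : ∀ t, |A t| ≤ C) : IntegrableOn (fun t => Real.exp (-2 * t / T) * A t) (Ioi 0) :=
  (integrableOn_exp_weight hT).mul_bdd (c := C) hA.aestronglyMeasurable (Eventually.of_forall hC)

/-- The squared modulus is a double integral over energies; Fubini performs the time average first.
The result is real, so only the real part of the averaged phase, the kernel `avgKernel`, survives.
-/
theorem timeAvg_fourier_le (hu : Measurable u) (hc : ∀ x, |u x| ≤ c) (hT : 0 < T) :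
    timeAvg (fun t => ‖∫ E, Complex.exp (-Complex.I * (E : ℂ) * (t : ℂ)) * (u E : ℂ) ∂m‖ ^ 2) T
      ≤ ∫ E, u E ^ 2 * ∫ E', avgKernel T (E - E') ∂m ∂m := by
  have hc0 : 0 ≤ c := (abs_nonneg _).trans (hc 0)
  set G : ℝ → ℂ := fun t => ∫ E, Complex.exp (-Complex.I * (E : ℂ) * (t : ℂ)) * (u E : ℂ) ∂m
    with hG
  let H : ℝ → ℝ × ℝ → ℂ := fun t p => ((2 / T * Real.exp (-2 * t / T) : ℝ) : ℂ)
    * ((Complex.exp (-Complex.I * (p.1 : ℂ) * (t : ℂ)) * (u p.1 : ℂ))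
      * (starRingEnd ℂ) (Complex.exp (-Complex.I * (p.2 : ℂ) * (t : ℂ)) * (u p.2 : ℂ)))
  have hA : ∀ t, ∫ p, H t p ∂(m.prod m) = ((2 / T * (Real.exp (-2 * t / T) * ‖G t‖ ^ 2) : ℝ) : ℂ) := by
    intro t
    simp only [H]
    rw [integral_const_mul, integral_prod_mul
      (fun E : ℝ => Complex.exp (-Complex.I * (E : ℂ) * (t : ℂ)) * (u E : ℂ))
      (fun E : ℝ => (starRingEnd ℂ) (Complex.exp (-Complex.I * (E : ℂ) * (t : ℂ)) * (u E : ℂ))),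
      integral_conj, Complex.mul_conj, Complex.normSq_eq_norm_sq]
    push_cast
    ring
  have hB : ∀ p : ℝ × ℝ, ∫ t in Ioi (0 : ℝ), H t p
      = ((u p.1 * u p.2 : ℝ) : ℂ) * (1 + Complex.I * (T * (p.1 - p.2) / 2 : ℝ))⁻¹ := by
    intro p
    rw [← timeAvg_exp T hT, ← integral_const_mul]
    refine integral_congr_ae (Eventually.of_forall fun t => ?_)
    simp only [H, map_mul, Complex.conj_ofReal, ← Complex.exp_conj, map_neg, Complex.conj_I]
    rw [show ∀ w e₁ u₁ e₂ u₂ : ℂ, w * (e₁ * u₁ * (e₂ * u₂)) = u₁ * u₂ * (w * (e₁ * e₂)) by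
      intros; ring, ← Complex.exp_add]
    push_cast
    congr 4
    ring
  have hH : Integrable (Function.uncurry H) ((volume.restrict (Ioi (0 : ℝ))).prod (m.prod m)) := by
    have hdom : Integrable (fun z : ℝ × ℝ × ℝ => (2 / T * Real.exp (-2 * z.1 / T)) * (c * c))
        ((volume.restrict (Ioi (0 : ℝ))).prod (m.prod m)) :=
      Integrable.mul_prod (f := fun t : ℝ => 2 / T * Real.exp (-2 * t / T))
        (g := fun _ : ℝ × ℝ => c * c) ((integrableOn_exp_weight hT).const_mul _)
        (integrable_const _)
    refine hdom.mono' ?_ (Eventually.of_forall fun z => ?_)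
    · refine Measurable.aestronglyMeasurable ?_
      simp only [H, Function.uncurry_def, map_mul, Complex.conj_ofReal]
      fun_prop
    · simp only [H, Function.uncurry_def]
      rw [norm_mul, norm_mul, RCLike.norm_conj, norm_mul, norm_mul,
        SpectralCalc.norm_exp_neg_I_mul, SpectralCalc.norm_exp_neg_I_mul, one_mul, one_mul,
        Complex.norm_real, Complex.norm_real, Complex.norm_real, Real.norm_of_nonneg (by positivity)]
      gcongr
      · exact hc _
      · exact hc _
  have hswap := integral_integral_swap hH
  simp only [hA, hB] at hswap
  rw [integral_complex_ofReal] at hswap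
  have hmeasK : Measurable fun p : ℝ × ℝ => avgKernel T (p.1 - p.2) :=
    ((continuous_avgKernel T).comp (by fun_prop)).measurable
  have hIR : Integrable (fun p : ℝ × ℝ => ((u p.1 * u p.2 : ℝ) : ℂ)
      * (1 + Complex.I * (T * (p.1 - p.2) / 2 : ℝ))⁻¹) (m.prod m) := by
    have := hH.integral_prod_right
    simpa only [Function.uncurry_def, hB] using this
  have hre := congrArg Complex.re hswap
  rw [Complex.ofReal_re, ← RCLike.re_eq_complex_re, ← integral_re hIR] at hre
  simp only [RCLike.re_eq_complex_re, Complex.re_ofReal_mul, re_inv_one_add_I_mul] at hre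
  rw [timeAvg, ← integral_const_mul, hre]
  have hb : ∀ p : ℝ × ℝ, ‖u p.1 ^ 2 * avgKernel T (p.1 - p.2)‖ ≤ c ^ 2 := by
    intro p
    rw [norm_mul, Real.norm_of_nonneg (avgKernel_nonneg _ _), norm_pow]
    calc ‖u p.1‖ ^ 2 * avgKernel T (p.1 - p.2) ≤ c ^ 2 * 1 := by
          gcongr
          · exact avgKernel_nonneg _ _
          · exact hc _
          · exact avgKernel_le_one _ _
      _ = c ^ 2 := mul_one _
  have hI1 : Integrable (fun p : ℝ × ℝ => u p.1 ^ 2 * avgKernel T (p.1 - p.2)) (m.prod m) :=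
    Integrable.of_bound (by fun_prop) _ (Eventually.of_forall hb)
  have hswap2 := integral_prod_swap (μ := m) (ν := m)
    (fun p : ℝ × ℝ => u p.1 ^ 2 * avgKernel T (p.1 - p.2))
  have hI2 := hI1.swap
  have hI2' : Integrable (fun p : ℝ × ℝ => u p.2 ^ 2 * avgKernel T (p.1 - p.2)) (m.prod m) := by
    refine hI2.congr (Eventually.of_forall fun p => ?_)
    simp only [Function.comp, Prod.fst_swap, Prod.snd_swap]
    rw [← neg_sub, avgKernel_neg]
  have hswap3 : ∫ p : ℝ × ℝ, u p.2 ^ 2 * avgKernel T (p.1 - p.2) ∂(m.prod m)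
      = ∫ p : ℝ × ℝ, u p.1 ^ 2 * avgKernel T (p.1 - p.2) ∂(m.prod m) := by
    rw [← hswap2]
    refine integral_congr_ae (Eventually.of_forall fun p => ?_)
    simp only [Prod.fst_swap, Prod.snd_swap]
    rw [← neg_sub, avgKernel_neg]
  have hfin : ∫ E, u E ^ 2 * ∫ E', avgKernel T (E - E') ∂m ∂m
      = ∫ p : ℝ × ℝ, u p.1 ^ 2 * avgKernel T (p.1 - p.2) ∂(m.prod m) := by
    rw [integral_prod _ hI1]
    simp only [integral_const_mul]
  rw [hfin]
  -- Arithmetic-geometric mean inequality; the two square terms contribute equally since the kernel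
  -- is even.
  calc ∫ p : ℝ × ℝ, u p.1 * u p.2 * avgKernel T (p.1 - p.2) ∂(m.prod m)
      ≤ ∫ p : ℝ × ℝ, 2⁻¹ * (u p.1 ^ 2 * avgKernel T (p.1 - p.2)
        + u p.2 ^ 2 * avgKernel T (p.1 - p.2)) ∂(m.prod m) := by
        refine integral_mono ?_ ((hI1.add hI2').const_mul _) fun p => ?_
        · refine (hI1.add hI2').mono' (by fun_prop) (Eventually.of_forall fun p => ?_)
          have := avgKernel_nonneg T (p.1 - p.2)
          simp only [Pi.add_apply]
          rw [← add_mul, norm_mul, Real.norm_of_nonneg this, Real.norm_eq_abs]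
          gcongr
          rw [abs_le]
          constructor <;> nlinarith [sq_nonneg (u p.1 - u p.2), sq_nonneg (u p.1 + u p.2)]
        · have := avgKernel_nonneg T (p.1 - p.2)
          simp only
          nlinarith [mul_nonneg (sq_nonneg (u p.1 - u p.2)) this]
    _ = _ := by
        rw [integral_const_mul, integral_add hI1 hI2', hswap3]
        ring

end

/-- A measure with local `α`-Hölder behaviour at `E`, `α ≤ 1`, has averaged kernel of size
`T ^ (-α)`. -/
theorem integral_avgKernel_le {μ : Measure ℝ} [IsFiniteMeasure μ] {E α C T : ℝ} (hα1 : α ≤ 1)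
    (hT : 0 < T) (hC : ∀ ε, 0 < ε → μ.real (Ioo (E - ε) (E + ε)) ≤ C * ε ^ α) :
    ∫ x, avgKernel T (E - x) ∂μ ≤ 32 * C * T ^ (-α) := by
  have hC0 : 0 ≤ C := by simpa using measureReal_nonneg.trans (hC 1 one_pos)
  let e : ℕ → ℝ := fun j => 2 ^ j / T
  have he : ∀ j, 0 < e j := fun j => by positivity
  -- Dyadic decomposition: if `j` is least with `T |E - x| < 2 ^ j`, then either `j = 0` or `T |E -
  -- x| ≥ 2 ^ (j - 1)`, and the kernel is at most `16 · 4^{-j}`.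
  have hpt : ∀ x, ENNReal.ofReal (avgKernel T (E - x))
      ≤ ∑' j : ℕ, (Ioo (E - e j) (E + e j)).indicator
        (fun _ => ENNReal.ofReal (16 * (1 / 4) ^ j)) x := by
    intro x
    have hex : ∃ j : ℕ, T * |E - x| < 2 ^ j := pow_unbounded_of_one_lt _ (by norm_num)
    have hj := Nat.find_spec hex
    have hmin : ∀ i < Nat.find hex, ¬ T * |E - x| < 2 ^ i := fun i hi => Nat.find_min hex hi
    set j := Nat.find hex
    refine le_trans ?_ (ENNReal.le_tsum j)
    have hmem : x ∈ Ioo (E - e j) (E + e j) := by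
      have h1 : |E - x| < e j := by
        rw [lt_div_iff₀ hT]; linarith
      rw [abs_lt] at h1
      constructor <;> linarith [h1.1, h1.2]
    rw [indicator_of_mem hmem]
    refine ENNReal.ofReal_le_ofReal ?_
    rcases hj0 : j with _ | i
    · exact (avgKernel_le_one _ _).trans (by norm_num)
    · have h2 := not_lt.mp (hmin i (by omega))
      have h3 : (4 : ℝ) ^ i ≤ (T * (E - x)) ^ 2 := by
        rw [← sq_abs, abs_mul, abs_of_pos hT]
        calc (4 : ℝ) ^ i = (2 ^ i) ^ 2 := by rw [← pow_mul, mul_comm, pow_mul]; norm_num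
          _ ≤ _ := by gcongr
      have h4 : (0 : ℝ) < 4 ^ i := by positivity
      rw [avgKernel, pow_succ]
      calc (1 + (T * (E - x) / 2) ^ 2)⁻¹ ≤ (4 ^ i / 4)⁻¹ := by
            gcongr
            rw [div_pow]
            linarith
        _ = _ := by
            rw [one_div, inv_pow]
            field_simp
            rw [pow_succ]
            ring
  have h1 : ∫⁻ x, ENNReal.ofReal (avgKernel T (E - x)) ∂μ
      ≤ ∑' j : ℕ, ENNReal.ofReal (16 * C * T ^ (-α) * (1 / 2) ^ j) := by
    refine (lintegral_mono hpt).trans ?_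
    rw [lintegral_tsum fun j => (measurable_const.indicator measurableSet_Ioo).aemeasurable]
    refine ENNReal.tsum_le_tsum fun j => ?_
    rw [lintegral_indicator_const measurableSet_Ioo, ← ofReal_measureReal,
      ← ENNReal.ofReal_mul (by positivity)]
    refine ENNReal.ofReal_le_ofReal ?_
    -- Here `α ≤ 1` enters: the mass grows at most like `2 ^ j` against the decay `4 ^ (-j)`,
    -- leaving a geometric series.
    have h2 : e j ^ α ≤ 2 ^ j * T ^ (-α) := by
      rw [Real.div_rpow (by positivity) hT.le, Real.rpow_neg hT.le, div_eq_mul_inv]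
      gcongr
      calc ((2 : ℝ) ^ j) ^ α ≤ (2 ^ j) ^ (1 : ℝ) :=
            Real.rpow_le_rpow_of_exponent_le (one_le_pow₀ (by norm_num)) hα1
        _ = _ := Real.rpow_one _
    calc 16 * (1 / 4 : ℝ) ^ j * μ.real (Ioo (E - e j) (E + e j))
        ≤ 16 * (1 / 4 : ℝ) ^ j * (C * (2 ^ j * T ^ (-α))) := by
          gcongr
          exact (hC _ (he j)).trans (by gcongr)
      _ = 16 * C * T ^ (-α) * ((1 / 4) ^ j * 2 ^ j) := by ring
      _ = _ := by rw [← mul_pow]; norm_num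
  have hsum : Summable fun j : ℕ => 16 * C * T ^ (-α) * (1 / 2 : ℝ) ^ j :=
    summable_geometric_two.mul_left _
  rw [← ENNReal.ofReal_tsum_of_nonneg (fun j => by positivity) hsum, tsum_mul_left,
    tsum_geometric_two] at h1
  rw [integral_eq_lintegral_of_nonneg_ae (Eventually.of_forall fun x => avgKernel_nonneg _ _)
    (integrable_avgKernel T E μ).aestronglyMeasurable]
  refine (ENNReal.toReal_mono ENNReal.ofReal_ne_top h1).trans ?_
  rw [ENNReal.toReal_ofReal (by positivity)]
  linarith

end HalfLine

/-! ### Local mass of a measure and its Hölder exponent -/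

namespace HalfLine

/-- The average of `μ` at scale `1/T` around `E`. -/
noncomputable def avgMass (μ : Measure ℝ) (T E : ℝ) : ℝ := ∫ x, avgKernel T (E - x) ∂μ

theorem avgMass_nonneg (μ : Measure ℝ) (T E : ℝ) : 0 ≤ avgMass μ T E :=
  integral_nonneg fun _ => avgKernel_nonneg _ _

theorem exists_bound_of_upperDeriv_lt_top {μ : Measure ℝ} {s E : ℝ} (h : upperDeriv μ s E < ⊤) :
    ∃ M : ℝ, 0 ≤ M ∧ ∃ ε₀ : ℝ, 0 < ε₀ ∧ ∀ ε, 0 < ε → ε < ε₀ →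
      μ.real (Ioo (E - ε) (E + ε)) ≤ M * (2 * ε) ^ s := by
  obtain ⟨K, hK, hKt⟩ := exists_between h
  have h1 := eventually_lt_of_limsup_lt hK
  rw [eventually_nhdsWithin_iff, Metric.eventually_nhds_iff] at h1
  obtain ⟨ε₀, hε₀, h2⟩ := h1
  refine ⟨K.toReal, ENNReal.toReal_nonneg, ε₀, hε₀, fun ε hε hlt => ?_⟩
  have h3 := h2 (y := ε) (by rw [Real.dist_eq, sub_zero, abs_of_pos hε]; exact hlt) hε
  have hpos : (0 : ℝ) < (2 * ε) ^ s := by positivity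
  have h4 := (ENNReal.div_le_iff (ENNReal.ofReal_pos.mpr hpos).ne' ENNReal.ofReal_ne_top).mp h3.le
  have h5 := ENNReal.toReal_mono (by finiteness) h4
  rwa [ENNReal.toReal_mul, ENNReal.toReal_ofReal hpos.le] at h5

section

variable (μ : Measure ℝ) [IsFiniteMeasure μ]

theorem continuous_avgMass (T : ℝ) : Continuous (avgMass μ T) := by
  refine continuous_of_dominated (bound := fun _ => 1)
    (fun E => (integrable_avgKernel T E μ).aestronglyMeasurable)
    (fun E => Eventually.of_forall fun x => ?_) (integrable_const 1)
    (Eventually.of_forall fun x => (continuous_avgKernel T).comp (continuous_id.sub continuous_const))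
  rw [Real.norm_of_nonneg (avgKernel_nonneg _ _)]
  exact avgKernel_le_one _ _

theorem avgMass_anti {T T' : ℝ} (hT : 0 ≤ T) (h : T ≤ T') (E : ℝ) :
    avgMass μ T' E ≤ avgMass μ T E :=
  integral_mono (integrable_avgKernel T' E μ) (integrable_avgKernel T E μ)
    fun _ => avgKernel_anti hT h _

theorem avgMass_restrict_le (B : Set ℝ) (T E : ℝ) : avgMass (μ.restrict B) T E ≤ avgMass μ T E :=
  setIntegral_le_integral (integrable_avgKernel T E μ)
    (Eventually.of_forall fun _ => avgKernel_nonneg _ _)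

variable {μ}

/-- Radii beyond `ε₀` cost only a constant, as the measure is finite and `s ≥ 0`. -/
theorem exists_global_bound_of_upperDeriv_lt_top {s E : ℝ} (hs : 0 ≤ s)
    (h : upperDeriv μ s E < ⊤) :
    ∃ C : ℝ, ∀ ε, 0 < ε → μ.real (Ioo (E - ε) (E + ε)) ≤ C * ε ^ s := by
  obtain ⟨M, hM, ε₀, hε₀, h1⟩ := exists_bound_of_upperDeriv_lt_top h
  refine ⟨M * 2 ^ s + μ.real univ * ε₀ ^ (-s), fun ε hε => ?_⟩
  have hp : 0 ≤ ε ^ s := by positivity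
  rcases lt_or_ge ε ε₀ with hlt | hge
  · refine (h1 ε hε hlt).trans ?_
    rw [Real.mul_rpow (by norm_num) hε.le, ← mul_assoc]
    gcongr
    exact le_add_of_nonneg_right (by positivity)
  · have h2 : 1 ≤ ε₀ ^ (-s) * ε ^ s := by
      rw [Real.rpow_neg hε₀.le, ← div_eq_inv_mul, one_le_div (by positivity)]
      exact Real.rpow_le_rpow hε₀.le hge hs
    calc μ.real (Ioo (E - ε) (E + ε)) ≤ μ.real univ := measureReal_mono (subset_univ _)
      _ ≤ μ.real univ * (ε₀ ^ (-s) * ε ^ s) := le_mul_of_one_le_right measureReal_nonneg h2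
      _ ≤ _ := by
        rw [add_mul, mul_assoc (μ.real univ)]
        exact le_add_of_nonneg_left (by positivity)

/-- A finite measure has no mass on the set where its upper `s`-derivative is finite for some
`s > 1`. -/
theorem ae_le_one_of_upperDeriv_lt_top (μ : Measure ℝ) [IsFiniteMeasure μ] :
    ∀ᵐ E ∂μ, ∀ s, upperDeriv μ s E < ⊤ → s ≤ 1 := by
  -- Differentiating Lebesgue measure with respect to `μ` gives a finite limit of `2r / μ(ball)` at
  -- `μ`-almost every `E`. Thus `μ(ball)` is at least a multiple of `r`, incompatible with `O(r ^
  -- s)` for `s > 1`.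
  filter_upwards [Besicovitch.ae_tendsto_rnDeriv volume μ, Measure.rnDeriv_lt_top volume μ]
    with E hE hlt s hs
  by_contra! h1
  obtain ⟨M, hM, ε₀, hε₀, hb⟩ := exists_bound_of_upperDeriv_lt_top hs
  obtain ⟨K, hK, hKt⟩ := exists_between hlt
  have h2 := hE.eventually_lt_const hK
  have h3 : ∀ᶠ r : ℝ in 𝓝[>] 0, 2 * r ≤ K.toReal * (M * (4 * r) ^ s) := by
    have h4 : ∀ᶠ r : ℝ in 𝓝[>] 0, r < ε₀ / 2 :=
      eventually_nhdsWithin_of_eventually_nhds (eventually_lt_nhds (by positivity))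
    filter_upwards [h2, h4, self_mem_nhdsWithin] with r hr hr4 hr0
    have hr0 : (0 : ℝ) < r := hr0
    rw [Real.volume_closedBall] at hr
    have hne : μ (Metric.closedBall E r) ≠ 0 := by
      intro h0
      rw [h0, ENNReal.div_zero (ENNReal.ofReal_pos.mpr (by positivity)).ne'] at hr
      exact not_top_lt hr
    have h5 := (ENNReal.div_le_iff hne (measure_ne_top _ _)).mp hr.le
    have h6 := ENNReal.toReal_mono (by finiteness) h5
    rw [ENNReal.toReal_mul, ENNReal.toReal_ofReal (by positivity)] at h6
    refine h6.trans ?_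
    gcongr
    refine le_trans (measureReal_mono ?_) ((hb (2 * r) (by positivity) (by linarith)).trans ?_)
    · intro x hx
      rw [Metric.mem_closedBall, Real.dist_eq, abs_le] at hx
      constructor <;> linarith [hx.1, hx.2]
    · rw [← mul_assoc]; norm_num
  have h7 : Tendsto (fun r : ℝ => K.toReal * M * 4 ^ s * r ^ (s - 1)) (𝓝[>] 0) (𝓝 0) := by
    have h8 : Tendsto (fun r : ℝ => r ^ (s - 1)) (𝓝[>] 0) (𝓝 0) := by
      have := (Real.continuousAt_rpow_const 0 (s - 1) (Or.inr (by linarith))).tendsto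
      rw [Real.zero_rpow (by linarith)] at this
      exact this.mono_left nhdsWithin_le_nhds
    simpa using h8.const_mul (K.toReal * M * 4 ^ s)
  obtain ⟨r, hr1, hr2, hr0⟩ := ((h7.eventually_lt_const (show (0 : ℝ) < 2 by norm_num)).and
    (h3.and self_mem_nhdsWithin)).exists
  have hr0 : (0 : ℝ) < r := hr0
  have h9 : K.toReal * (M * (4 * r) ^ s) = K.toReal * M * 4 ^ s * r ^ (s - 1) * r := by
    rw [Real.mul_rpow (by norm_num) hr0.le, Real.rpow_sub_one hr0.ne']
    field_simp
  rw [h9] at hr2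
  nlinarith

end

/-! ### Truncated norms, growth of solutions and uniform sets of energies -/

section TruncNorm

variable {F : Type*}

theorem truncNormSq_natCast [Norm F] (φ : ℕ → F) (n : ℕ) :
    truncNormSq φ n = ∑ i ∈ Finset.Icc 1 n, ‖φ i‖ ^ 2 := by
  simp [truncNormSq]

theorem truncNormSq_of_lt_one [Norm F] (φ : ℕ → F) {L : ℝ} (hL : L < 1) :
    truncNormSq φ L = L * ‖φ 1‖ ^ 2 := by
  simp [truncNormSq, Nat.floor_eq_zero.mpr hL]

variable [NormedAddCommGroup F]

theorem truncNormSq_nonneg (φ : ℕ → F) {L : ℝ} (hL : 0 ≤ L) : 0 ≤ truncNormSq φ L :=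
  add_nonneg (by positivity) (mul_nonneg (sub_nonneg.mpr (Nat.floor_le hL)) (by positivity))

theorem truncNormSq_le_sum (φ : ℕ → F) {L : ℝ} (hL : 0 ≤ L) {M : ℕ} (hLM : L ≤ M) :
    truncNormSq φ L ≤ ∑ i ∈ Finset.Icc 1 M, ‖φ i‖ ^ 2 := by
  have h1 : ⌊L⌋₊ ≤ M := by
    have := Nat.floor_le_floor hLM
    rwa [Nat.floor_natCast] at this
  rcases h1.eq_or_lt with h2 | h2
  · have h3 : L = M := le_antisymm hLM (h2 ▸ Nat.floor_le hL)
    rw [h3, truncNormSq_natCast]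
  · refine le_trans (b := ∑ i ∈ Finset.Icc 1 (⌊L⌋₊ + 1), ‖φ i‖ ^ 2) ?_
      (Finset.sum_le_sum_of_subset_of_nonneg (Finset.Icc_subset_Icc_right h2)
        fun _ _ _ => by positivity)
    rw [truncNormSq, Finset.sum_Icc_succ_top (by omega)]
    gcongr
    have := Nat.lt_floor_add_one L
    exact mul_le_of_le_one_left (by positivity) (by linarith)

theorem sum_norm_sq_add_le (φ χ : ℕ → F) (s : Finset ℕ) :
    ∑ i ∈ s, ‖φ i + χ i‖ ^ 2 ≤ 2 * ∑ i ∈ s, ‖φ i‖ ^ 2 + 2 * ∑ i ∈ s, ‖χ i‖ ^ 2 := by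
  rw [Finset.mul_sum, Finset.mul_sum, ← Finset.sum_add_distrib]
  refine Finset.sum_le_sum fun i _ => ?_
  nlinarith [norm_add_le (φ i) (χ i), norm_nonneg (φ i + χ i), sq_nonneg (‖φ i‖ - ‖χ i‖),
    norm_nonneg (φ i), norm_nonneg (χ i)]

theorem sum_atSite_le (ψ : L2) (M : ℕ) :
    ∑ i ∈ Finset.Icc 1 M, ‖atSite ψ i‖ ^ 2 ≤ ‖ψ‖ ^ 2 := by
  have h := lp.sum_rpow_le_norm_rpow (p := 2) (by norm_num) ψ (Finset.range M)
  norm_num at h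
  refine le_trans (le_of_eq ?_) h
  induction M with
  | zero => simp
  | succ M ih =>
    rw [Finset.sum_Icc_succ_top (by omega), Finset.sum_range_succ, ih]
    · rfl
    · have h' := lp.sum_rpow_le_norm_rpow (p := 2) (by norm_num) ψ (Finset.range M)
      norm_num at h'
      exact h'

theorem atSite_add (φ χ : L2) (n : ℕ) : atSite (φ + χ : L2) n = atSite φ n + atSite χ n := by
  cases n <;> simp [atSite]

end TruncNorm

theorem growth_of_limsup_lt_top {u : ℕ → ℝ} (hu : u 1 = 1) {γ : ℝ}
    (h : limsup (fun L : ℝ => ENNReal.ofReal (L ^ (-γ) * truncNormSq u L)) atTop < ⊤) :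
    0 ≤ γ ∧ ∃ C : ℝ, ∀ n : ℕ, 1 ≤ n → ∑ i ∈ Finset.Icc 1 n, ‖u i‖ ^ 2 ≤ C * (n : ℝ) ^ γ := by
  obtain ⟨K, hK, hKt⟩ := exists_between h
  have h1 := eventually_lt_of_limsup_lt hK
  have h2 : ∀ᶠ n : ℕ in atTop, ∑ i ∈ Finset.Icc 1 n, ‖u i‖ ^ 2 ≤ K.toReal * (n : ℝ) ^ γ := by
    filter_upwards [tendsto_natCast_atTop_atTop.eventually h1, eventually_ge_atTop 1] with n hn hn1
    have hn0 : (0 : ℝ) < n := by exact_mod_cast hn1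
    rw [truncNormSq_natCast] at hn
    have h3 := ENNReal.toReal_mono hKt.ne hn.le
    rw [ENNReal.toReal_ofReal (by positivity), Real.rpow_neg hn0.le,
      inv_mul_le_iff₀ (by positivity)] at h3
    linarith
  have hone : ∀ n : ℕ, 1 ≤ n → 1 ≤ ∑ i ∈ Finset.Icc 1 n, ‖u i‖ ^ 2 := by
    intro n hn
    calc (1 : ℝ) = ‖u 1‖ ^ 2 := by simp [hu]
      _ ≤ _ := Finset.single_le_sum (f := fun i => ‖u i‖ ^ 2) (fun _ _ => by positivity)
        (Finset.mem_Icc.mpr ⟨le_rfl, hn⟩)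
  -- Since `u 1 = 1`, the truncated norms stay at least one, so the growth bound cannot decay.
  have hγ : 0 ≤ γ := by
    by_contra! hneg
    have h4 : Tendsto (fun n : ℕ => K.toReal * (n : ℝ) ^ γ) atTop (𝓝 0) := by
      have := ((tendsto_rpow_neg_atTop (show 0 < -γ by linarith)).comp
        tendsto_natCast_atTop_atTop).const_mul K.toReal
      simpa [Function.comp_def] using this
    obtain ⟨n, hn1, hn2, hn3⟩ := ((h4.eventually_lt_const one_pos).and
      (h2.and (eventually_ge_atTop 1))).exists
    linarith [hone n hn3]
  refine ⟨hγ, ?_⟩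
  obtain ⟨n₀, hn₀⟩ := eventually_atTop.mp h2
  refine ⟨max K.toReal (∑ i ∈ Finset.Icc 1 n₀, ‖u i‖ ^ 2), fun n hn => ?_⟩
  have hn1 : (1 : ℝ) ≤ n := by exact_mod_cast hn
  rcases le_total n₀ n with hle | hle
  · refine (hn₀ n hle).trans ?_
    gcongr
    exact le_max_left _ _
  · calc ∑ i ∈ Finset.Icc 1 n, ‖u i‖ ^ 2 ≤ ∑ i ∈ Finset.Icc 1 n₀, ‖u i‖ ^ 2 :=
        Finset.sum_le_sum_of_subset_of_nonneg (Finset.Icc_subset_Icc_right hle)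
          fun _ _ _ => by positivity
      _ ≤ max K.toReal (∑ i ∈ Finset.Icc 1 n₀, ‖u i‖ ^ 2) * 1 := by
        rw [mul_one]; exact le_max_right _ _
      _ ≤ _ := by
        gcongr
        exact Real.one_le_rpow hn1 hγ

/-- The energies in `[-N, N]` at which the continuity of the measure and the growth of `u₀` are
controlled with the constant `N`. -/
def uniformSet (a v : ℕ → ℝ) (μ : Measure ℝ) (α γ : ℝ → ℝ) (N : ℕ) : Set ℝ :=
  {E | E ∈ Icc (-(N : ℝ)) N ∧ α E ≤ 1 ∧ 1 ≤ N * γ E ∧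
    (∀ k : ℕ, avgMass μ ((k : ℝ) + 1) E ≤ N * ((k : ℝ) + 1) ^ (-α E)) ∧
    ∀ n : ℕ, ∑ i ∈ Finset.Icc 1 (n + 1), ‖dirichletSol a v E i‖ ^ 2 ≤ N * ((n : ℝ) + 1) ^ γ E}

/-- Only integer scales occur in the definition, which makes the set a countable intersection. -/
theorem measurableSet_uniformSet (a v : ℕ → ℝ) (μ : Measure ℝ) [IsFiniteMeasure μ] {α γ : ℝ → ℝ}
    (hα : Measurable α) (hγ : Measurable γ) (N : ℕ) :
    MeasurableSet (uniformSet a v μ α γ N) := by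
  have h1 := fun T => (continuous_avgMass μ T).measurable
  have h2 := fun n => (continuous_dirichletSol a v n).measurable
  have h3 : uniformSet a v μ α γ N = Icc (-(N : ℝ)) N ∩ ({E | α E ≤ 1} ∩ ({E | 1 ≤ N * γ E} ∩
      ((⋂ k : ℕ, {E | avgMass μ ((k : ℝ) + 1) E ≤ N * ((k : ℝ) + 1) ^ (-α E)}) ∩
      ⋂ n : ℕ, {E | ∑ i ∈ Finset.Icc 1 (n + 1), ‖dirichletSol a v E i‖ ^ 2
        ≤ N * ((n : ℝ) + 1) ^ γ E}))) := by
    ext E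
    simp only [uniformSet, mem_inter_iff, mem_iInter, mem_ofPred_eq]
  rw [h3]
  refine measurableSet_Icc.inter (.inter (measurableSet_le hα measurable_const) (.inter
    (measurableSet_le measurable_const (hγ.const_mul _)) (.inter ?_ ?_)))
  · exact .iInter fun k => measurableSet_le (h1 _) (by fun_prop)
  · exact .iInter fun n => measurableSet_le (by fun_prop) (by fun_prop)

theorem monotone_uniformSet (a v : ℕ → ℝ) (μ : Measure ℝ) (α γ : ℝ → ℝ) :
    Monotone (uniformSet a v μ α γ) := by
  rintro N N' hNN E ⟨h1, h2, h3, h4, h5⟩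
  have hN : (N : ℝ) ≤ N' := by exact_mod_cast hNN
  have hγ : 0 ≤ γ E := by
    by_contra! h
    nlinarith [mul_nonneg N.cast_nonneg (neg_nonneg.mpr h.le) (α := ℝ)]
  refine ⟨⟨by linarith [h1.1], by linarith [h1.2]⟩, h2, h3.trans (by gcongr), fun k => ?_, fun n => ?_⟩
  · exact (h4 k).trans (by gcongr)
  · exact (h5 n).trans (by gcongr)

theorem exists_mem_uniformSet (a v : ℕ → ℝ) {μ : Measure ℝ} [IsFiniteMeasure μ] {α γ : ℝ → ℝ}
    {b : ℝ} (hb : 0 < b) {E : ℝ} (hα : α E ≤ 1) (hD : upperDeriv μ (α E) E < ⊤)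
    (hG : limsup (fun L : ℝ => ENNReal.ofReal
        (L ^ (-γ E) * truncNormSq (dirichletSol a v E) L)) atTop < ⊤)
    (hη : b ≤ α E / γ E) : ∃ N, E ∈ uniformSet a v μ α γ N := by
  obtain ⟨hγ0, C₁, hC₁⟩ := growth_of_limsup_lt_top (by rfl) hG
  -- Division by zero gives `0 < b`, so `γ E = 0` is excluded by the lower bound on the quotient.
  have hγ : 0 < γ E := by
    refine hγ0.lt_of_ne fun h => ?_
    rw [← h, div_zero] at hη
    linarith
  have hα0 : 0 ≤ α E := by
    rw [le_div_iff₀ hγ] at hη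
    exact (mul_pos hb hγ).le.trans hη
  obtain ⟨C₂, hC₂⟩ := exists_global_bound_of_upperDeriv_lt_top hα0 hD
  obtain ⟨N, hN⟩ := exists_nat_ge (max (max |E| (γ E)⁻¹) (max C₁ (32 * C₂)))
  simp only [max_le_iff] at hN
  obtain ⟨⟨hN1, hN2⟩, hN3, hN4⟩ := hN
  refine ⟨N, abs_le.mp hN1, hα, ?_, fun k => ?_, fun n => ?_⟩
  · rwa [inv_le_iff_one_le_mul₀ hγ] at hN2
  · refine (integral_avgKernel_le hα (by positivity) hC₂).trans ?_
    gcongr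
  · refine (hC₁ (n + 1) (by omega)).trans ?_
    push_cast
    gcongr

/-- The local mass decreases in `T`, so the bound at `⌊T⌋₊ ≥ T / 2` carries over to `T`; the loss `2
^ α` is at most `2` because `α ≤ 1`. -/
theorem avgMass_le_of_mem_uniformSet {a v : ℕ → ℝ} {μ : Measure ℝ} [IsFiniteMeasure μ]
    {α γ : ℝ → ℝ} {N : ℕ} {E T : ℝ} (hE : E ∈ uniformSet a v μ α γ N) (hα : 0 ≤ α E)
    (hT : 1 ≤ T) : avgMass μ T E ≤ 2 * N * T ^ (-α E) := by
  obtain ⟨-, h2, -, h4, -⟩ := hE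
  obtain ⟨k, hk⟩ : ∃ k, ⌊T⌋₊ = k + 1 := ⟨⌊T⌋₊ - 1, by have := Nat.floor_pos.mpr hT; omega⟩
  have hk1 : (k : ℝ) + 1 ≤ T := by
    have := Nat.floor_le (show 0 ≤ T by linarith)
    rw [hk] at this
    exact_mod_cast this
  have hk2 : T / 2 ≤ (k : ℝ) + 1 := by
    have := Nat.lt_floor_add_one T
    rw [hk] at this
    push_cast at this
    have := k.cast_nonneg (α := ℝ)
    linarith
  refine (avgMass_anti μ (by positivity) hk1 E).trans ((h4 k).trans ?_)
  rw [mul_comm (2 : ℝ), mul_assoc]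
  gcongr
  calc ((k : ℝ) + 1) ^ (-α E) ≤ (T / 2) ^ (-α E) :=
        Real.rpow_le_rpow_of_nonpos (by positivity) hk2 (by linarith)
    _ = 2 ^ α E * T ^ (-α E) := by
        rw [Real.div_rpow (by linarith) (by norm_num), Real.rpow_neg (by norm_num : (0:ℝ) ≤ 2)]
        field_simp
    _ ≤ 2 * T ^ (-α E) := by
        gcongr
        calc (2 : ℝ) ^ α E ≤ 2 ^ (1 : ℝ) := Real.rpow_le_rpow_of_exponent_le (by norm_num) h2
          _ = 2 := Real.rpow_one _

/-- The product of the growth of `u₀` and of the local mass, at matching scales. -/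
theorem growth_mul_avgMass_le {a v : ℕ → ℝ} {μ : Measure ℝ} [IsFiniteMeasure μ]
    {α γ : ℝ → ℝ} {N : ℕ} {E T b r : ℝ} (hE : E ∈ uniformSet a v μ α γ N) (hb : 0 < b)
    (hη : b ≤ α E / γ E) (hT : 1 ≤ T) {M : ℕ} (hM : 1 ≤ M) (hr1 : r ≤ 1)
    (hMr : (M : ℝ) ≤ r * T ^ b) :
    (∑ i ∈ Finset.Icc 1 M, dirichletSol a v E i ^ 2) * avgMass μ T E
      ≤ 2 * (N : ℝ) ^ 2 * r ^ (1 / (N : ℝ)) := by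
  have hT0 : 0 < T := by linarith
  have hM0 : (0 : ℝ) < M := by exact_mod_cast hM
  have hr0 : 0 < r := by
    by_contra! h
    linarith [mul_nonpos_of_nonpos_of_nonneg h (show 0 ≤ T ^ b by positivity)]
  have h3 := hE.2.2.1
  have hN0 : (0 : ℝ) < N := by
    refine N.cast_nonneg.lt_of_ne fun h => ?_
    rw [← h] at h3
    linarith
  have hγ : 1 / (N : ℝ) ≤ γ E := by rwa [div_le_iff₀' hN0]
  have hγ0 : 0 < γ E := lt_of_lt_of_le (by positivity) hγ
  have hαγ : b * γ E ≤ α E := (le_div_iff₀ hγ0).mp hη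
  have h1 := avgMass_le_of_mem_uniformSet hE ((by positivity : 0 ≤ b * γ E).trans hαγ) hT
  have h2 := hE.2.2.2.2 (M - 1)
  rw [Nat.sub_add_cancel hM, Nat.cast_sub hM, Nat.cast_one, sub_add_cancel] at h2
  simp only [Real.norm_eq_abs, sq_abs] at h2
  have h4 : (M : ℝ) ^ γ E ≤ r ^ γ E * T ^ (b * γ E) := by
    rw [Real.rpow_mul hT0.le, ← Real.mul_rpow hr0.le (by positivity)]
    gcongr
  have h5 : T ^ (-α E) ≤ T ^ (-(b * γ E)) :=
    Real.rpow_le_rpow_of_exponent_le hT (by linarith)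
  calc (∑ i ∈ Finset.Icc 1 M, dirichletSol a v E i ^ 2) * avgMass μ T E
      ≤ (N * (r ^ γ E * T ^ (b * γ E))) * (2 * N * T ^ (-(b * γ E))) := by
        gcongr
        · exact avgMass_nonneg _ _ _
        · exact h2.trans (by gcongr)
        · exact h1.trans (by gcongr)
    _ = 2 * (N : ℝ) ^ 2 * r ^ γ E := by
        rw [Real.rpow_neg hT0.le]
        have : T ^ (b * γ E) ≠ 0 := by positivity
        field_simp
    -- The condition `γ E ≥ 1 / N` makes the smallness in `r ≤ 1` uniform in `E`.
    _ ≤ _ := by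
        gcongr ?_ * ?_
        exact Real.rpow_le_rpow_of_exponent_ge hr0 hr1 hγ

end HalfLine

/-! ### Escape of the wavepacket from boxes of size `C T ^ b` -/

namespace HalfLine

open SpectralCalc

/-- Only the majorant needs regularity. This matters for the evolution over an unbounded `S`, whose
continuity in time is not established. -/
theorem timeAvg_mono {A A' : ℝ → ℝ} {T : ℝ} (hT : 0 < T) (h0 : ∀ t, 0 ≤ A t)
    (h : ∀ t, A t ≤ A' t) (hA' : Continuous A') {C : ℝ} (hC : ∀ t, |A' t| ≤ C) :
    timeAvg A T ≤ timeAvg A' T := by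
  refine mul_le_mul_of_nonneg_left ?_ (by positivity)
  refine integral_mono_of_nonneg (Eventually.of_forall fun t => mul_nonneg (Real.exp_nonneg _) (h0 t))
    (integrableOn_weight_mul_of_bounded hT hA' hC) (Eventually.of_forall fun t => ?_)
  exact mul_le_mul_of_nonneg_left (h t) (Real.exp_nonneg _)

theorem timeAvg_const {T : ℝ} (hT : 0 < T) (d : ℝ) : timeAvg (fun _ => d) T = d := by
  rw [timeAvg, integral_mul_const, integral_exp_weight hT]
  field_simp

theorem timeAvg_le_const {A : ℝ → ℝ} {T d : ℝ} (hT : 0 < T) (h0 : ∀ t, 0 ≤ A t)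
    (h : ∀ t, A t ≤ d) : timeAvg A T ≤ d :=
  (timeAvg_mono hT h0 h continuous_const (fun _ => le_rfl)).trans (timeAvg_const hT d).le

theorem timeAvg_affine {A : ℝ → ℝ} {T : ℝ} (hT : 0 < T) (hA : Continuous A) {C : ℝ}
    (hC : ∀ t, |A t| ≤ C) (r d : ℝ) :
    timeAvg (fun t => r * A t + d) T = r * timeAvg A T + d := by
  have h1 := (integrableOn_weight_mul_of_bounded hT hA hC).const_mul r
  have h2 := (integrableOn_exp_weight hT).mul_const d
  have h3 : ∀ t, Real.exp (-2 * t / T) * (r * A t + d)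
      = r * (Real.exp (-2 * t / T) * A t) + Real.exp (-2 * t / T) * d := fun t => by ring
  simp only [timeAvg, h3]
  rw [integral_add h1 h2, integral_const_mul, integral_mul_const, integral_exp_weight hT]
  field_simp

theorem timeAvg_sum {A : ℕ → ℝ → ℝ} {T : ℝ} (hT : 0 < T) (hA : ∀ n, Continuous (A n)) {C : ℕ → ℝ}
    (hC : ∀ n t, |A n t| ≤ C n) (s : Finset ℕ) :
    timeAvg (fun t => ∑ n ∈ s, A n t) T = ∑ n ∈ s, timeAvg (A n) T := by
  simp only [timeAvg, Finset.mul_sum]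
  rw [integral_finsetSum _ fun n _ => integrableOn_weight_mul_of_bounded hT (hA n) (hC n),
    Finset.mul_sum]

variable {a v : ℕ → ℝ}

/-- `H₊` is self-adjoint when `∑ |a(n)|⁻¹ = ∞`, so it has a spectral resolution; the definitions
assign the zero projections and the zero measure to an operator without one. -/
theorem spectralProj_eq_zero (hA : ¬ ∃ P, IsSpectralResolution (jacobiOp a v) P) :
    spectralProj (jacobiOp a v) = 0 := by
  rw [spectralProj, dif_neg hA]

theorem muPlus_eq_zero (hA : ¬ ∃ P, IsSpectralResolution (jacobiOp a v) P) :
    muPlus a v = 0 := by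
  rw [muPlus, spectralMeasure, spectralProj_eq_zero hA, pvmMeasure, dif_neg]
  intro hP
  have h := hP.norm_sq_apply .univ delta1
  rw [hP.pvmMeasure_real_univ, norm_delta1] at h
  simp at h

theorem muPlus_real_univ (hA : ∃ P, IsSpectralResolution (jacobiOp a v) P) :
    (muPlus a v).real univ = 1 := by
  rw [muPlus, spectralMeasure,
    (isSpectralResolution_spectralProj hA).isPVM.pvmMeasure_real_univ, norm_delta1, one_pow]

instance muPlus_isFinite : IsFiniteMeasure (muPlus a v) := pvmMeasure_isFinite _

/-- Over a bounded set of energies, every site amplitude is continuous and bounded in time, and its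
time average is controlled by `u₀` and the local mass of `μ⁺`. -/
theorem amplitude_bounds (ha : ∀ n, 1 ≤ n → a n ≠ 0)
    (hA : ∃ P, IsSpectralResolution (jacobiOp a v) P) {R : ℝ} {B : Set ℝ}
    (hB : MeasurableSet B) (hBR : B ⊆ Icc (-R) R) (n : ℕ) :
    let A : ℝ → ℝ := fun t =>
      ‖atSite (evolution (jacobiOp a v) t (spectralProj (jacobiOp a v) B delta1)) n‖ ^ 2
    Continuous A ∧ (∃ C, ∀ t, |A t| ≤ C) ∧ ∀ T, 0 < T → timeAvg A T
      ≤ ∫ E in B, dirichletSol a v E n ^ 2 * avgMass (muPlus a v) T E ∂(muPlus a v) := by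
  intro A
  set μ := muPlus a v with hμ
  have hcont := continuous_dirichletSol a v n
  -- Cutting off outside `B` turns the solution, bounded only on compact sets, into a globally
  -- bounded function.
  let u : ℝ → ℝ := B.indicator fun E => dirichletSol a v E n
  have hu : Measurable u := hcont.measurable.indicator hB
  obtain ⟨c, hc⟩ : ∃ c, ∀ x, |u x| ≤ c := by
    obtain ⟨c, hc⟩ := isCompact_Icc.exists_bound_of_continuousOn (s := Icc (-R) R) hcont.continuousOn
    refine ⟨max c 0, fun x => ?_⟩
    by_cases hx : x ∈ B
    · simp only [u, indicator_of_mem hx]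
      exact (hc x (hBR hx)).trans (le_max_left _ _)
    · simp only [u, indicator_of_notMem hx, abs_zero]
      exact le_max_right _ _
  have hAu : A = fun t : ℝ => ‖∫ E, Complex.exp (-Complex.I * (E : ℂ) * (t : ℂ)) * (u E : ℂ)
      ∂(μ.restrict B)‖ ^ 2 := by
    funext t
    simp only [A]
    rw [atSite_evolution_proj_delta1 ha hA n hB hBR t]
    congr 2
    refine setIntegral_congr_fun hB fun E hE => ?_
    simp only [u, indicator_of_mem hE]
  refine ⟨?_, ?_, fun T hT => ?_⟩
  · rw [hAu]
    exact (continuous_fourier hu hc).norm.pow 2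
  · rw [hAu]
    refine ⟨(c * (μ.restrict B).real univ) ^ 2, fun t => ?_⟩
    rw [abs_of_nonneg (by positivity)]
    exact pow_le_pow_left₀ (norm_nonneg _) (norm_fourier_le hc t) 2
  · rw [hAu]
    refine (timeAvg_fourier_le hu hc hT).trans (le_of_eq_of_le (setIntegral_congr_fun hB
      (g := fun E => dirichletSol a v E n ^ 2 * avgMass (μ.restrict B) T E) fun E hE => ?_) ?_)
    · simp only [u, indicator_of_mem hE, avgMass]
    · have h1 := continuous_avgMass (μ.restrict B) T
      have h2 := continuous_avgMass μ T
      refine setIntegral_mono (integrableOn_of_continuous_of_bounded hBR μ (by fun_prop))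
        (integrableOn_of_continuous_of_bounded hBR μ (by fun_prop)) fun E => ?_
      exact mul_le_mul_of_nonneg_left (avgMass_restrict_le μ B T E) (sq_nonneg _)

theorem timeAvg_amplitude_sum_le (ha : ∀ n, 1 ≤ n → a n ≠ 0)
    (hA : ∃ P, IsSpectralResolution (jacobiOp a v) P) {R : ℝ} {B : Set ℝ}
    (hB : MeasurableSet B) (hBR : B ⊆ Icc (-R) R) {T D : ℝ} (hT : 0 < T) {M : ℕ}
    (hD : ∀ E ∈ B, (∑ i ∈ Finset.Icc 1 M, dirichletSol a v E i ^ 2) * avgMass (muPlus a v) T E ≤ D)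
    (hD0 : 0 ≤ D) :
    timeAvg (fun t => ∑ i ∈ Finset.Icc 1 M,
      ‖atSite (evolution (jacobiOp a v) t (spectralProj (jacobiOp a v) B delta1)) i‖ ^ 2) T ≤ D := by
  have h := fun n => amplitude_bounds ha hA hB hBR n
  choose h1 h2 h3 using h
  choose C hC using h2
  have hc := fun n => continuous_dirichletSol a v n
  have hm := continuous_avgMass (muPlus a v) T
  rw [timeAvg_sum hT h1 hC]
  refine (Finset.sum_le_sum fun n _ => h3 n T hT).trans ?_
  rw [← integral_finsetSum _ fun n _ =>
    (integrableOn_of_continuous_of_bounded hBR (muPlus a v) (by fun_prop) :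
      IntegrableOn (fun E => dirichletSol a v E n ^ 2 * avgMass (muPlus a v) T E) B _)]
  calc ∫ E in B, ∑ i ∈ Finset.Icc 1 M,
        dirichletSol a v E i ^ 2 * avgMass (muPlus a v) T E ∂(muPlus a v)
      ≤ ∫ _ in B, D ∂(muPlus a v) := by
        refine setIntegral_mono_on (integrableOn_of_continuous_of_bounded hBR _ (by fun_prop))
          (integrable_const _) hB fun E hE => ?_
        rw [← Finset.sum_mul]
        exact hD E hE
    _ = (muPlus a v).real B * D := by rw [setIntegral_const, smul_eq_mul]
    _ ≤ 1 * D := by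
        gcongr
        rw [← muPlus_real_univ hA]
        exact measureReal_mono (subset_univ _)
    _ = D := one_mul D

theorem norm_sq_evolution_proj_delta1_le (hA : ∃ P, IsSpectralResolution (jacobiOp a v) P)
    {B : Set ℝ} (hB : MeasurableSet B) (t : ℝ) :
    ‖evolution (jacobiOp a v) t (spectralProj (jacobiOp a v) B delta1)‖ ^ 2
      ≤ 4 * (muPlus a v).real B := by
  have h := norm_evolution_le hA t (spectralProj (jacobiOp a v) B delta1)
  rw [muPlus, spectralMeasure, ← (isSpectralResolution_spectralProj hA).isPVM.norm_sq_apply hB]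
  nlinarith [norm_nonneg (evolution (jacobiOp a v) t (spectralProj (jacobiOp a v) B delta1))]

/-- Almost every energy in `S` lies in some uniform set, and these increase with `N`; continuity
from above of the finite measure does the rest. -/
theorem exists_uniformSet_diff_lt {α γ : ℝ → ℝ} (hα : Measurable α) (hγ : Measurable γ)
    (hD : ∀ᵐ E ∂(muPlus a v), upperDeriv (muPlus a v) (α E) E < ⊤)
    (hG : ∀ᵐ E ∂(muPlus a v), limsup (fun L : ℝ => ENNReal.ofReal
        (L ^ (-γ E) * truncNormSq (dirichletSol a v E) L)) atTop < ⊤)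
    {S : Set ℝ} (hS : MeasurableSet S) {b : ℝ} (hb : 0 < b) (hη : ∀ E ∈ S, b ≤ α E / γ E)
    {g : ℝ} (hg : 0 < g) :
    ∃ N : ℕ, (muPlus a v).real (S \ uniformSet a v (muPlus a v) α γ N) < g := by
  set μ := muPlus a v
  have hnull : μ (⋂ N, S \ uniformSet a v μ α γ N) = 0 := by
    refine measure_mono_null (t := {E | ¬ (E ∈ S → ∃ N, E ∈ uniformSet a v μ α γ N)}) ?_ ?_
    · intro E hE
      simp only [mem_iInter, Set.mem_sdiff] at hE
      simp only [mem_ofPred_eq, not_forall, not_exists]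
      exact ⟨(hE 0).1, fun N => (hE N).2⟩
    · refine ae_iff.mp ?_
      filter_upwards [hD, hG, ae_le_one_of_upperDeriv_lt_top μ] with E h1 h2 h3 hE
      exact exists_mem_uniformSet a v hb (h3 _ h1) h1 h2 (hη E hE)
  have hlim := tendsto_measure_iInter_atTop (μ := μ)
    (s := fun N => S \ uniformSet a v μ α γ N)
    (fun N => (hS.diff (measurableSet_uniformSet a v μ hα hγ N)).nullMeasurableSet)
    (fun N N' h => sdiff_subset_sdiff_right (monotone_uniformSet a v μ α γ h))
    ⟨0, measure_ne_top _ _⟩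
  rw [hnull] at hlim
  obtain ⟨N, hN⟩ := (hlim.eventually_lt_const (ENNReal.ofReal_pos.mpr hg)).exists
  exact ⟨N, (ENNReal.lt_ofReal_iff_toReal_lt (measure_ne_top _ _)).mp hN⟩

/-- The part of the wavepacket carried by energies with `η ≥ b` leaves every box of size `c T ^ b`
with `c` small, uniformly in `T`. -/
theorem exists_timeAvg_truncNormSq_le (ha : ∀ n, 1 ≤ n → a n ≠ 0)
    (hA : ∃ P, IsSpectralResolution (jacobiOp a v) P)
    {α γ : ℝ → ℝ} (hα : Measurable α) (hγ : Measurable γ)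
    (hD : ∀ᵐ E ∂(muPlus a v), upperDeriv (muPlus a v) (α E) E < ⊤)
    (hG : ∀ᵐ E ∂(muPlus a v), limsup (fun L : ℝ => ENNReal.ofReal
        (L ^ (-γ E) * truncNormSq (dirichletSol a v E) L)) atTop < ⊤)
    {S : Set ℝ} (hS : MeasurableSet S) {b : ℝ} (hb : 0 < b) (hη : ∀ E ∈ S, b ≤ α E / γ E)
    {g : ℝ} (hg : 0 < g) :
    ∃ C : ℝ, 0 < C ∧ ∀ T : ℝ, 0 < T →
      timeAvg (fun t => truncNormSq (atSite (evolution (jacobiOp a v) t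
        (spectralProj (jacobiOp a v) S delta1))) (C * T ^ b)) T ≤ g := by
  -- The discarded energies contribute `2 · 4 · g/16 = g/2`: a two from splitting the square, a four
  -- from the norm bound on the evolution.
  obtain ⟨N, hN⟩ := exists_uniformSet_diff_lt hα hγ hD hG hS hb hη (show 0 < g / 16 by positivity)
  set μ := muPlus a v with hμ
  set B := S ∩ uniformSet a v μ α γ N with hBdef
  have hUm := measurableSet_uniformSet a v μ hα hγ N
  have hB : MeasurableSet B := hS.inter hUm
  have hBR : B ⊆ Icc (-(N : ℝ)) N := fun E hE => hE.2.1
  obtain ⟨r, hr0, hr1, hr⟩ : ∃ r : ℝ, 0 < r ∧ r ≤ 1 ∧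
      2 * (N : ℝ) ^ 2 * r ^ (1 / (N : ℝ)) ≤ g / 4 := by
    rcases Nat.eq_zero_or_pos N with h0 | h0
    -- For `N = 0` the exponent `1 / N` is `0` by convention, but the prefactor vanishes.
    · exact ⟨1, one_pos, le_rfl, by rw [h0]; norm_num; positivity⟩
    have h0' : (0 : ℝ) < N := by exact_mod_cast h0
    have h1 : Tendsto (fun r : ℝ => 2 * (N : ℝ) ^ 2 * r ^ (1 / (N : ℝ))) (𝓝[>] 0) (𝓝 0) := by
      have := (Real.continuousAt_rpow_const 0 (1 / (N : ℝ)) (Or.inr (by positivity))).tendsto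
      rw [Real.zero_rpow (by positivity)] at this
      simpa using (this.mono_left nhdsWithin_le_nhds).const_mul (2 * (N : ℝ) ^ 2)
    have h2 : ∀ᶠ r : ℝ in 𝓝[>] 0, r < 1 :=
      eventually_nhdsWithin_of_eventually_nhds (eventually_lt_nhds one_pos)
    obtain ⟨r, h3, h4, h5⟩ := ((h1.eventually_lt_const (show 0 < g / 4 by positivity)).and
      (h2.and self_mem_nhdsWithin)).exists
    exact ⟨r, h5, h4.le, h3.le⟩
  -- `T₀ ^ b = 2 / r`
  set T₀ : ℝ := (2 / r) ^ (1 / b) with hT₀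
  have hT₀b : T₀ ^ b = 2 / r := by
    rw [hT₀, ← Real.rpow_mul (by positivity), one_div_mul_cancel hb.ne', Real.rpow_one]
  have hT₀1 : 1 ≤ T₀ := Real.one_le_rpow ((one_le_div hr0).mpr (by linarith)) (by positivity)
  have hT₀0 : 0 < T₀ := by linarith
  -- For `T < T₀` this keeps the box below `min (1/2) (g/4)`, hence within a fraction of the first
  -- site. For `T ≥ T₀`, where `r T ^ b ≥ 2`, rounding `(r/2) T ^ b` up to an integer stays below `r
  -- T ^ b`.
  set C : ℝ := r / 2 * min (1 / 2) (g / 4) with hCdef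
  have hmin : 0 < min (1 / 2) (g / 4) := lt_min (by norm_num) (by positivity)
  have hC0 : 0 < C := by positivity
  have hCr : C ≤ r / 2 := by
    have : min (1 / 2) (g / 4) ≤ 1 := (min_le_left _ _).trans (by norm_num)
    exact mul_le_of_le_one_right (by positivity) this
  refine ⟨C, hC0, fun T hT => ?_⟩
  have hL0 : 0 ≤ C * T ^ b := by positivity
  have hnn : ∀ t, 0 ≤ truncNormSq (atSite (evolution (jacobiOp a v) t
      (spectralProj (jacobiOp a v) S delta1))) (C * T ^ b) := fun t => truncNormSq_nonneg _ hL0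
  rcases lt_or_ge T T₀ with hlt | hge
  · have hL : C * T ^ b ≤ min (1 / 2) (g / 4) := by
      calc C * T ^ b ≤ C * T₀ ^ b := by gcongr
        _ = min (1 / 2) (g / 4) := by rw [hT₀b, hCdef]; field_simp
    have hL1 : C * T ^ b < 1 := by linarith [hL.trans (min_le_left _ _)]
    refine timeAvg_le_const hT hnn fun t => ?_
    rw [truncNormSq_of_lt_one _ hL1]
    have h1 := norm_sq_evolution_proj_delta1_le hA hS t
    have h2 : (muPlus a v).real S ≤ 1 := by
      rw [← muPlus_real_univ hA]; exact measureReal_mono (subset_univ _)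
    have h3 := sum_atSite_le (evolution (jacobiOp a v) t (spectralProj (jacobiOp a v) S delta1)) 1
    rw [Finset.Icc_self, Finset.sum_singleton] at h3
    calc _ ≤ (g / 4) * 4 := by
          gcongr
          · exact hL.trans (min_le_right _ _)
          · linarith
      _ = g := by ring
  · have hT1 : 1 ≤ T := hT₀1.trans hge
    have hTb : 2 / r ≤ T ^ b := by rw [← hT₀b]; gcongr
    have hTb' : 2 ≤ r * T ^ b := by rwa [div_le_iff₀' hr0] at hTb
    obtain ⟨M, hM1, hLM, hMr⟩ : ∃ M : ℕ, 1 ≤ M ∧ C * T ^ b ≤ M ∧ (M : ℝ) ≤ r * T ^ b := by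
      have h1 : 1 ≤ r / 2 * T ^ b := by linarith
      refine ⟨⌈r / 2 * T ^ b⌉₊, Nat.ceil_pos.mpr (by positivity), ?_, ?_⟩
      · exact le_trans (by gcongr) (Nat.le_ceil _)
      · have := Nat.ceil_lt_add_one (show 0 ≤ r / 2 * T ^ b by positivity)
        linarith
    let X : ℝ → ℝ := fun t => ∑ i ∈ Finset.Icc 1 M,
      ‖atSite (evolution (jacobiOp a v) t (spectralProj (jacobiOp a v) B delta1)) i‖ ^ 2
    have hX : timeAvg X T ≤ g / 4 := by
      refine timeAvg_amplitude_sum_le ha hA hB hBR hT (fun E hE => ?_) (by positivity)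
      exact (growth_mul_avgMass_le hE.2 hb (hη E hE.1) hT1 hM1 hr1 hMr).trans hr
    have hXc : Continuous X := continuous_finsetSum _ fun i _ => (amplitude_bounds ha hA hB hBR i).1
    have hX0 : ∀ t, 0 ≤ X t := fun t => Finset.sum_nonneg fun _ _ => by positivity
    have hXb : ∀ t, |X t| ≤ 4 := by
      intro t
      rw [abs_of_nonneg (hX0 t)]
      have h2 : (muPlus a v).real B ≤ 1 := by
        rw [← muPlus_real_univ hA]; exact measureReal_mono (subset_univ _)
      have h3 := sum_atSite_le (evolution (jacobiOp a v) t (spectralProj (jacobiOp a v) B delta1)) M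
      have h1 := norm_sq_evolution_proj_delta1_le hA hB t
      exact h3.trans (by linarith)
    have hle : ∀ t, truncNormSq (atSite (evolution (jacobiOp a v) t
        (spectralProj (jacobiOp a v) S delta1))) (C * T ^ b) ≤ 2 * X t + g / 2 := by
      intro t
      refine (truncNormSq_le_sum _ hL0 hLM).trans ?_
      have h1 : spectralProj (jacobiOp a v) S delta1 = spectralProj (jacobiOp a v) B delta1
          + spectralProj (jacobiOp a v) (S \ uniformSet a v μ α γ N) delta1 := by
        rw [← (isSpectralResolution_spectralProj hA).isPVM.union_apply hB (hS.diff hUm)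
          (disjoint_sdiff_inter.symm), inter_union_sdiff]
      simp only [h1, map_add, atSite_add]
      refine (sum_norm_sq_add_le _ _ _).trans ?_
      have h2 := sum_atSite_le (evolution (jacobiOp a v) t
        (spectralProj (jacobiOp a v) (S \ uniformSet a v μ α γ N) delta1)) M
      have h3 := norm_sq_evolution_proj_delta1_le hA (hS.diff hUm) t
      simp only [X]
      linarith
    refine (timeAvg_mono hT hnn hle (by fun_prop) (C := 2 * 4 + g / 2) fun t => ?_).trans ?_
    · have := hXb t
      rw [abs_of_nonneg (hX0 t)] at this
      rw [abs_of_nonneg (by linarith [hX0 t])]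
      linarith
    · rw [timeAvg_affine hT hXc hXb]
      linarith

end HalfLine

theorem theorem1p4
    -- the coefficients of `H₊`
    (a v : ℕ → ℝ) (ha : ∀ n, 1 ≤ n → a n ≠ 0)
    (hsum : ¬ Summable fun n : ℕ => |a (n + 1)|⁻¹)
    -- the exponents `α(E)` and `γ(E)`
    (α γ : ℝ → ℝ) (hα : Measurable α) (hγ : Measurable γ)
    (hD : ∀ᵐ E ∂(HalfLine.muPlus a v), HalfLine.upperDeriv (HalfLine.muPlus a v) (α E) E < ⊤)
    (hG : ∀ᵐ E ∂(HalfLine.muPlus a v),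
      limsup (fun L : ℝ => ENNReal.ofReal
        (L ^ (-γ E) * HalfLine.truncNormSq (HalfLine.dirichletSol a v E) L)) atTop < ⊤)
    (S : Set ℝ) (hS : MeasurableSet S) (b : ℝ) (hb : 0 < b)
    (hη : ∀ E ∈ S, b ≤ α E / γ E) :
    ∀ g : ℝ, 0 < g → ∃ C : ℝ, 0 < C ∧ ∀ T : ℝ, 0 < T →
      HalfLine.timeAvg (fun t => HalfLine.truncNormSq
          (HalfLine.atSite (SpectralCalc.evolution (HalfLine.jacobiOp a v) t
            (SpectralCalc.spectralProj (HalfLine.jacobiOp a v) S HalfLine.delta1)))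
          (C * T ^ b)) T
        ≤ 1 - (HalfLine.muPlus a v).real {E | b ≤ α E / γ E} + g := by
  intro g hg
  by_cases hA : ∃ P, SpectralCalc.IsSpectralResolution (HalfLine.jacobiOp a v) P
  · obtain ⟨C, hC, h⟩ := HalfLine.exists_timeAvg_truncNormSq_le ha hA hα hγ hD hG hS hb hη hg
    refine ⟨C, hC, fun T hT => (h T hT).trans ?_⟩
    have h1 : (HalfLine.muPlus a v).real {E | b ≤ α E / γ E} ≤ 1 := by
      rw [← HalfLine.muPlus_real_univ hA]
      exact measureReal_mono (subset_univ _)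
    linarith
  -- Without a spectral resolution the default values make the left side `0` and the right side `1 +
  -- g`.
  · refine ⟨1, one_pos, fun T hT => ?_⟩
    rw [HalfLine.muPlus_eq_zero hA, HalfLine.spectralProj_eq_zero hA]
    have h0 : ∀ n, HalfLine.atSite ((0 : HalfLine.L2) : ℕ → ℂ) n = 0 := by
      intro n
      cases n <;> rfl
    simp only [Pi.zero_apply, zero_apply, map_zero, HalfLine.truncNormSq, h0]
    simp [HalfLine.timeAvg]
    linarith
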